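/- Let $\theta>0$, let $W=(W_t)_{t\ge 0}$ be a standard Brownian motion on a probability space, and let $X=(X_t)_{t\ge0}$ be the Ornstein--Uhlenbeck process solving $$X_0=0,\qquad dX_t=-\theta X_t\,dt+dW_t,\quad t\ge 0.$$ Let $(\Delta_n)_{n\ge1}$ be positive step sizes. For $n\ge1$, put $t_i=i\Delta_n$ ($i=0,\dots,n$) and $T=T_n=n\Delta_n$, and consider the approximate minimum contrast estimator $$\widetilde\theta_n=\frac{1}{\frac{2}{n}\sum_{i=1}^{n}X_{t_i}^2}.$$ Suppose that $\Delta_n\to0$ and $n\Delta_n\to\infty$ as $n\to\infty$. Then $\widetilde\theta_n\to\theta$ in probability. If, moreover, $n\Delta_n^{\eta}\to0$ for some $1<\eta<2$, or $n\Delta_n^{\eta}\to\infty$ for some $\eta>1$, then $\widetilde\theta_n\to\theta$ almost surely. -/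

import Mathlib

open MeasureTheory ProbabilityTheory Filter Topology
open scoped NNReal

/-- `X` solves the Ornstein-Uhlenbeck equation `X₀ = 0`, `dX_t = -θ X_t dt + dW_t`, `t ≥ 0`, driven
by `W`: almost surely, the path of `X` is continuous and satisfies the integrated equation
`X_t = X_0 - ∫₀ᵗ θ X_s ds + (W_t - W_0)` for all `t ≥ 0`. The noise is additive, so the equation
is read pathwise and involves no stochastic integral of a random integrand. -/
structure IsOrnsteinUhlenbeck {Ω : Type*} [MeasurableSpace Ω] (θ : ℝ) (W X : ℝ≥0 → Ω → ℝ)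
    (P : Measure Ω) : Prop where
  cont : ∀ᵐ ω ∂P, Continuous (fun t : ℝ≥0 => X t ω)
  init : ∀ᵐ ω ∂P, X 0 ω = 0
  sde : ∀ᵐ ω ∂P, ∀ t : ℝ≥0,
    X t ω = X 0 ω + (∫ s in (0 : ℝ)..(t : ℝ), -θ * X s.toNNReal ω) + (W t ω - W 0 ω)

/-- The approximate minimum contrast estimator based on the `n` observations of `X` at the times
`t_i = i δ`, `i = 1, …, n`, with step size `δ`. -/
noncomputable def approxMinContrast {Ω : Type*} (X : ℝ≥0 → Ω → ℝ) (δ : ℝ≥0) (n : ℕ) (ω : Ω) : ℝ :=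
  1 / ((2 / (n : ℝ)) * ∑ i ∈ Finset.Icc 1 n, (X ((i : ℝ≥0) * δ) ω) ^ 2)

/-! The estimator is `1 / (2 S)`, where `S` is the sample mean of the squared observations, and `1 /
(2θ)` is the stationary variance of the process. So it suffices that `S` tends to `1 / (2θ)`.

Gaussianity comes without stochastic integration: almost surely each `X t` is the limit of Riemann
sums of `∫₀ᵗ exp (-θ (t - s)) dW_s`. These are linear in `W` and their covariances converge to
`ouCov` (`IsOrnsteinUhlenbeck.isCenteredGaussian`). Sampled with step `δ`, `X` is an autoregression
with coefficient `ρ = exp (-θδ)` and innovations independent of the past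
(`IsCenteredGaussian.isGaussianAR`).

Squaring the recursion and summing (`autoregression_energy`) expresses `(1 - ρ²) ∑ Y_i²` through a
martingale, a sum of squared innovations and the endpoint `Y_n²`. Chernoff bounds for the three
terms give `P(|S - 1/(2θ)| ≥ ε) ≤ 6 exp (-c n δ)` for small `δ`
(`exists_measure_sampleSecondMoment_le`). With `nΔ_n → ∞` this is convergence in probability.

If `nΔ_n^η → ∞`, then `nΔ_n` eventually exceeds a positive power of `n`, the bounds are summable,
and Borel-Cantelli applies. If `nΔ_n^η → 0` with `η < 2`, then `∑ Δ_n² < ∞`. Since `S` differs from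
the time average of `X²` over `[0, nΔ_n]` by an error with fourth moment `O(Δ_n²)`, that error
vanishes almost surely. The time average converges by ergodicity, which follows from the same two
estimates on an auxiliary grid (`IsCenteredGaussian.ae_tendsto_timeSecondMoment`). -/

/-! ### Centered Gaussian processes and their almost sure limits. -/

section CenteredGaussian

variable {Ω T : Type*} [MeasurableSpace Ω] {P : Measure Ω}

/-- A process is centered Gaussian with covariance `K`. -/
structure IsCenteredGaussian (X : T → Ω → ℝ) (K : T → T → ℝ) (P : Measure Ω) : Prop where
  gaussian : IsGaussianProcess X P
  mean : ∀ t, ∫ ω, X t ω ∂P = 0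
  cov : ∀ s t, cov[X s, X t; P] = K s t

namespace IsCenteredGaussian

variable {X : T → Ω → ℝ} {K : T → T → ℝ}

theorem memLp_two (h : IsCenteredGaussian X K P) (t : T) : MemLp (X t) 2 P :=
  (h.gaussian.hasGaussianLaw_eval t).memLp_two

theorem congr {Y : T → Ω → ℝ} (h : IsCenteredGaussian X K P) (hXY : ∀ t, X t =ᵐ[P] Y t) :
    IsCenteredGaussian Y K P where
  gaussian := h.gaussian.congr hXY
  mean t := by rw [← h.mean t]; exact integral_congr_ae (hXY t).symm
  cov s t := by
    rw [← h.cov s t, covariance, covariance, integral_congr_ae (hXY s), integral_congr_ae (hXY t)]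
    refine integral_congr_ae ?_
    filter_upwards [hXY s, hXY t] with ω h1 h2
    rw [h1, h2]

theorem hasLaw_sum (h : IsCenteredGaussian X K P) {ι : Type*} [Fintype ι] (c : ι → ℝ) (t : ι → T) :
    HasLaw (fun ω => ∑ i, c i * X (t i) ω)
      (gaussianReal 0 (∑ i, ∑ j, c i * c j * K (t i) (t j)).toNNReal) P := by
  classical
  have hY : IsGaussianProcess (fun (_ : Unit) ω => ∑ i, c i * X (t i) ω) P := by
    have hg := h.gaussian
    refine hg.of_isGaussianProcess fun _ => ⟨Finset.univ.image t,
      { toFun x := ∑ i, c i * x ⟨t i, by simp⟩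
        map_add' x y := by simp [mul_add, Finset.sum_add_distrib]
        map_smul' a x := by simp only [Pi.smul_apply, smul_eq_mul, Finset.mul_sum, RingHom.id_apply]
                            exact Finset.sum_congr rfl fun i _ => by ring
        cont := by fun_prop }, fun ω => by simp [Finset.restrict]⟩
  have hG := hY.hasGaussianLaw_eval ()
  have := hG.isProbabilityMeasure
  have hm : ∀ i, MemLp (fun ω => c i * X (t i) ω) 2 P := fun i => (h.memLp_two (t i)).const_mul _
  refine ⟨hG.aemeasurable, ?_⟩
  rw [hG.map_eq_gaussianReal]
  congr 2
  · rw [integral_finsetSum _ fun i _ => (hm i).integrable (by norm_num)]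
    simp [integral_const_mul, h.mean]
  · rw [← covariance_self hG.aemeasurable, covariance_fun_sum_fun_sum hm hm]
    refine Finset.sum_congr rfl fun i _ => Finset.sum_congr rfl fun j _ => ?_
    rw [covariance_const_mul_left, covariance_const_mul_right]
    rw [h.cov]; ring

theorem hasLaw_linear (h : IsCenteredGaussian X K P) (a b : ℝ) (s t : T) :
    HasLaw (fun ω => a * X s ω + b * X t ω)
      (gaussianReal 0 (a ^ 2 * K s s + a * b * K s t + (a * b * K t s + b ^ 2 * K t t)).toNNReal)
      P := by
  have := h.hasLaw_sum ![a, b] ![s, t]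
  simp only [Fin.sum_univ_two, Matrix.cons_val_zero, Matrix.cons_val_one] at this
  convert this using 3
  ring

end IsCenteredGaussian

/-- Characteristic functions pass to the limit by dominated convergence, and the Gaussian one is
continuous in the variance. -/
theorem hasLaw_gaussianReal_of_tendsto_ae {Z : ℕ → Ω → ℝ} {Z' : Ω → ℝ} {v : ℕ → ℝ≥0} {v' : ℝ≥0}
    (hZ : ∀ k, HasLaw (Z k) (gaussianReal 0 (v k)) P) (hv : Tendsto v atTop (𝓝 v'))
    (hlim : ∀ᵐ ω ∂P, Tendsto (fun k => Z k ω) atTop (𝓝 (Z' ω))) :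
    HasLaw Z' (gaussianReal 0 v') P := by
  have hm : AEMeasurable Z' P :=
    aemeasurable_of_tendsto_metrizable_ae atTop (fun k => (hZ k).aemeasurable) hlim
  have hP : IsProbabilityMeasure P := (hZ 0).isProbabilityMeasure
  have := Measure.isProbabilityMeasure_map hm
  refine ⟨hm, Measure.ext_of_charFun ?_⟩
  ext u
  rw [charFun_apply_real, charFun_gaussianReal, integral_map hm (by fun_prop)]
  have h1 : Tendsto (fun k => ∫ ω, Complex.exp (u * Z k ω * Complex.I) ∂P) atTop
      (𝓝 (∫ ω, Complex.exp (u * Z' ω * Complex.I) ∂P)) := by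
    refine tendsto_integral_of_dominated_convergence (fun _ => 1) (fun k => ?_) (by fun_prop)
      (fun k => ?_) ?_
    · have := (hZ k).aemeasurable
      exact AEMeasurable.aestronglyMeasurable (by fun_prop)
    · refine Eventually.of_forall fun ω => ?_
      rw [← Complex.ofReal_mul, Complex.norm_exp_ofReal_mul_I]
    · filter_upwards [hlim] with ω hω
      exact (((Complex.continuous_exp.comp ((continuous_const.mul Complex.continuous_ofReal).mul
        continuous_const)).tendsto (Z' ω)).comp hω :)
  have h2 : ∀ k, ∫ ω, Complex.exp (u * Z k ω * Complex.I) ∂P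
      = Complex.exp (u * (0 : ℝ) * Complex.I - (v k : ℝ) * u ^ 2 / 2) := by
    intro k
    have h := charFun_gaussianReal (μ := 0) (v := v k) u
    rw [← (hZ k).map_eq, charFun_apply_real, integral_map (hZ k).aemeasurable (by fun_prop)] at h
    exact h
  simp_rw [h2] at h1
  refine tendsto_nhds_unique h1 ?_
  have hv' : Tendsto (fun k => (((v k : ℝ≥0) : ℝ) : ℂ)) atTop (𝓝 ((v' : ℝ) : ℂ)) :=
    (Complex.continuous_ofReal.tendsto _).comp ((NNReal.continuous_coe.tendsto _).comp hv)
  exact (Complex.continuous_exp.tendsto _).comp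
    (tendsto_const_nhds.sub ((hv'.mul_const _).div_const _))

/-- Cramér-Wold: a linear functional on `ℝ^I` is a linear combination of the coordinates. -/
theorem isGaussianProcess_of_hasLaw_sum {X : T → Ω → ℝ} (hX : ∀ t, AEMeasurable (X t) P)
    (h : ∀ (I : Finset T) (c : I → ℝ), ∃ v : ℝ≥0,
      HasLaw (fun ω => ∑ i, c i * X i ω) (gaussianReal 0 v) P) :
    IsGaussianProcess X P where
  hasGaussianLaw I := by
    classical
    have hm : AEMeasurable (fun ω => I.restrict (X · ω)) P :=
      aemeasurable_pi_lambda _ fun i => hX i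
    refine ⟨isGaussian_of_map_eq_gaussianReal fun L => ?_⟩
    obtain ⟨v, hv⟩ := h I fun i => L (Pi.single i 1)
    refine ⟨0, v, ?_⟩
    rw [AEMeasurable.map_map_of_aemeasurable (by fun_prop) hm, ← hv.map_eq]
    congr 1
    ext ω
    have : I.restrict (X · ω) = ∑ i : I, X i ω • Pi.single i (1 : ℝ) := by
      ext j
      simp [Finset.sum_apply, Pi.single_apply]
    rw [Function.comp_apply, this, map_sum]
    simp [mul_comm]

theorem IsCenteredGaussian.hasLaw_sum_of_tendsto {Y : ℕ → T → Ω → ℝ} {X : T → Ω → ℝ}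
    {L : ℕ → T → T → ℝ} {K : T → T → ℝ} (hY : ∀ k, IsCenteredGaussian (Y k) (L k) P)
    (hlim : ∀ t, ∀ᵐ ω ∂P, Tendsto (fun k => Y k t ω) atTop (𝓝 (X t ω)))
    (hcov : ∀ s t, Tendsto (fun k => L k s t) atTop (𝓝 (K s t)))
    {ι : Type*} [Fintype ι] (c : ι → ℝ) (t : ι → T) :
    HasLaw (fun ω => ∑ i, c i * X (t i) ω)
      (gaussianReal 0 (∑ i, ∑ j, c i * c j * K (t i) (t j)).toNNReal) P := by
  refine hasLaw_gaussianReal_of_tendsto_ae (fun k => (hY k).hasLaw_sum c t)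
    ((continuous_real_toNNReal.tendsto _).comp ?_) ?_
  · exact tendsto_finsetSum _ fun i _ => tendsto_finsetSum _ fun j _ => (hcov _ _).const_mul _
  · filter_upwards [ae_all_iff.2 fun i : ι => hlim (t i)] with ω hω
    exact tendsto_finsetSum _ fun i _ => (hω i).const_mul _

/-- Pointwise almost sure limits of centered Gaussian processes with converging covariances are
centered Gaussian. -/
theorem IsCenteredGaussian.of_tendsto {Y : ℕ → T → Ω → ℝ} {X : T → Ω → ℝ} {L : ℕ → T → T → ℝ}
    {K : T → T → ℝ} (hY : ∀ k, IsCenteredGaussian (Y k) (L k) P)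
    (hlim : ∀ t, ∀ᵐ ω ∂P, Tendsto (fun k => Y k t ω) atTop (𝓝 (X t ω)))
    (hcov : ∀ s t, Tendsto (fun k => L k s t) atTop (𝓝 (K s t))) :
    IsCenteredGaussian X K P := by
  have hP : IsProbabilityMeasure P := (hY 0).gaussian.isProbabilityMeasure
  have h1 : ∀ t, HasLaw (X t) (gaussianReal 0 (K t t).toNNReal) P := fun t => by
    simpa using hasLaw_sum_of_tendsto hY hlim hcov (fun _ : Unit => 1) (fun _ => t)
  have hG : IsGaussianProcess X P := isGaussianProcess_of_hasLaw_sum (fun t => (h1 t).aemeasurable)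
    fun I c => ⟨_, hasLaw_sum_of_tendsto hY hlim hcov c (fun i => i)⟩
  have hm : ∀ t, MemLp (X t) 2 P := fun t => (hG.hasGaussianLaw_eval t).memLp_two
  have hK : ∀ t, 0 ≤ K t t := fun t => ge_of_tendsto' (hcov t t) fun k => by
    rw [← (hY k).cov, covariance_self ((hY k).gaussian.aemeasurable t)]
    exact variance_nonneg _ _
  have hvar : ∀ t, Var[X t; P] = K t t := fun t => by
    rw [(h1 t).variance_eq, variance_id_gaussianReal, Real.coe_toNNReal _ (hK t)]
  have hsymm : ∀ s t, K s t = K t s := fun s t => tendsto_nhds_unique (hcov s t)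
    ((hcov t s).congr fun k => by rw [← (hY k).cov, covariance_comm, (hY k).cov])
  refine ⟨hG, fun t => by rw [(h1 t).integral_eq, integral_id_gaussianReal], fun s t => ?_⟩
  -- Polarization: the covariance is read off from the limit law of `X s + X t`, so no uniform
  -- integrability is needed.
  have h2 := hasLaw_sum_of_tendsto hY hlim hcov (fun _ : Fin 2 => 1) ![s, t]
  simp only [Fin.sum_univ_two, Matrix.cons_val_zero, Matrix.cons_val_one, one_mul] at h2
  have hpos : 0 ≤ K s s + K s t + (K t s + K t t) := by
    refine ge_of_tendsto' (((hcov s s).add (hcov s t)).add ((hcov t s).add (hcov t t))) fun k => ?_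
    rw [← (hY k).cov, ← (hY k).cov, ← (hY k).cov, ← (hY k).cov,
      covariance_comm (Y k t) (Y k s), covariance_self ((hY k).gaussian.aemeasurable s),
      covariance_self ((hY k).gaussian.aemeasurable t)]
    have := variance_add ((hY k).memLp_two s) ((hY k).memLp_two t)
    have := variance_nonneg (Y k s + Y k t) P
    linarith
  have h3 := variance_add (hm s) (hm t)
  have h4 : Var[X s + X t; P] = K s s + K s t + (K t s + K t t) := by
    have := h2.variance_eq
    rw [variance_id_gaussianReal, Real.coe_toNNReal _ hpos] at this
    exact this
  rw [h4, hvar, hvar, hsymm t s] at h3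
  linarith

end CenteredGaussian

/-! ### Pathwise convergence of Riemann sums to the solution. -/

section PathwiseApproximation

/-- The Riemann sum of mesh `h` for the stochastic convolution `∫₀ᵗ exp (-θ (t - s)) dw_s`. -/
noncomputable def convSum (θ : ℝ) (w : ℝ≥0 → ℝ) (h t : ℝ≥0) : ℝ :=
  ∑ j ∈ Finset.range ⌊t / h⌋₊,
    Real.exp (-θ * (t - j * h)) * (w ((j + 1 : ℕ) * h) - w ((j : ℕ) * h))

theorem floor_div_mul_le_self (t : ℝ≥0) {h : ℝ≥0} (hh : 0 < h) : (⌊t / h⌋₊ : ℝ≥0) * h ≤ t := by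
  calc (⌊t / h⌋₊ : ℝ≥0) * h ≤ (t / h) * h := by gcongr; exact Nat.floor_le zero_le
    _ = t := div_mul_cancel₀ _ hh.ne'

theorem tendsto_floor_div_mul {h : ℕ → ℝ≥0} (hpos : ∀ k, 0 < h k) (h0 : Tendsto h atTop (𝓝 0))
    (t : ℝ≥0) : Tendsto (fun k => ((⌊t / h k⌋₊ : ℝ≥0) * h k : ℝ≥0)) atTop (𝓝 t) := by
  have hl : Tendsto (fun k => (t : ℝ) - h k) atTop (𝓝 t) := by
    simpa using tendsto_const_nhds.sub ((NNReal.continuous_coe.tendsto 0).comp h0)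
  rw [← NNReal.tendsto_coe]
  refine tendsto_of_tendsto_of_tendsto_of_le_of_le hl tendsto_const_nhds (fun k => ?_)
    fun k => NNReal.coe_le_coe.2 (floor_div_mul_le_self t (hpos k))
  have hk : (0 : ℝ) < h k := hpos k
  have h1 : (t / h k : ℝ≥0) < (⌊t / h k⌋₊ : ℝ≥0) + 1 := Nat.lt_floor_add_one _
  have h2 : (t : ℝ) / h k < (⌊t / h k⌋₊ : ℝ) + 1 := by exact_mod_cast h1
  rw [div_lt_iff₀ hk] at h2
  push_cast
  linarith

/-- Discrete integrating factor: the equation turns an increment of `w` into one of `x` plus `θ ∫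
x`, and `exp (θjh) x(jh)` telescopes. What remains in each cell is `θ ∫ x - (exp (θh) - 1)
x((j+1)h)`, small by the modulus of continuity `ε` and the second-order error of `exp`. -/
theorem abs_sum_exp_mul_sub_le {θ : ℝ} (hθ : 0 < θ) {x : ℝ → ℝ} {w : ℝ≥0 → ℝ} {t h ε C : ℝ}
    {m : ℕ} (hx : Continuous x)
    (hsde : ∀ s : ℝ≥0, x s = x 0 + (∫ u in (0 : ℝ)..s, -θ * x u) + (w s - w 0)) (h0 : x 0 = 0)
    {h' : ℝ≥0} (hh' : (h' : ℝ) = h) (hm : m * h ≤ t) (hh1 : θ * h ≤ 1)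
    (hC : ∀ s ∈ Set.Icc 0 t, |x s| ≤ C)
    (hε : ∀ s ∈ Set.Icc 0 t, ∀ u ∈ Set.Icc 0 t, |s - u| ≤ h → |x s - x u| ≤ ε) (ht : 0 ≤ t) :
    |∑ j ∈ Finset.range m, Real.exp (θ * (j * h)) * (w ((j + 1 : ℕ) * h') - w ((j : ℕ) * h'))
      - Real.exp (θ * (m * h)) * x (m * h)| ≤ Real.exp (θ * t) * (t * (θ * ε + θ ^ 2 * h * C)) := by
  have hh : 0 ≤ h := hh' ▸ h'.2
  have hC0 : 0 ≤ C := (abs_nonneg _).trans (hC 0 ⟨le_rfl, ht⟩)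
  have hε0 : 0 ≤ ε := (abs_nonneg _).trans (hε 0 ⟨le_rfl, ht⟩ 0 ⟨le_rfl, ht⟩ (by simpa using hh))
  have hint : ∀ a b : ℝ, IntervalIntegrable x volume a b := fun a b => hx.intervalIntegrable a b
  have hinc : ∀ j : ℕ, w ((j + 1 : ℕ) * h') - w ((j : ℕ) * h') =
      x ((j + 1 : ℕ) * h) - x (j * h) + θ * ∫ u in (j * h : ℝ)..((j + 1 : ℕ) * h), x u := by
    intro j
    have e1 := hsde ((j + 1 : ℕ) * h')
    have e2 := hsde ((j : ℕ) * h')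
    rw [intervalIntegral.integral_const_mul] at e1 e2
    simp only [NNReal.coe_mul, NNReal.coe_natCast, hh'] at e1 e2
    rw [← intervalIntegral.integral_add_adjacent_intervals (hint 0 (j * h)) (hint _ _)] at e1
    rw [e1, e2]; ring
  have hrem : ∀ j ∈ Finset.range m, |(1 - Real.exp (θ * h)) * x ((j + 1 : ℕ) * h)
      + θ * ∫ u in (j * h : ℝ)..((j + 1 : ℕ) * h), x u| ≤ h * (θ * ε + θ ^ 2 * h * C) := by
    intro j hj
    have hjm : ((j + 1 : ℕ) : ℝ) ≤ m := by exact_mod_cast Finset.mem_range.1 hj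
    have hb : ((j + 1 : ℕ) : ℝ) * h ≤ t := (mul_le_mul_of_nonneg_right hjm hh).trans hm
    have ha : (0 : ℝ) ≤ j * h := by positivity
    have hab : ((j + 1 : ℕ) : ℝ) * h = j * h + h := by push_cast; ring
    have hbm : ((j + 1 : ℕ) : ℝ) * h ∈ Set.Icc 0 t := ⟨by positivity, hb⟩
    have i1 : |(∫ u in (j * h : ℝ)..((j + 1 : ℕ) * h), x u) - h * x ((j + 1 : ℕ) * h)| ≤ ε * h := by
      have : h * x ((j + 1 : ℕ) * h)
          = ∫ u in (j * h : ℝ)..((j + 1 : ℕ) * h), x ((j + 1 : ℕ) * h) := by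
        rw [intervalIntegral.integral_const, hab, smul_eq_mul]; ring
      rw [this, ← intervalIntegral.integral_sub (hint _ _) (by simp), ← Real.norm_eq_abs]
      refine (intervalIntegral.norm_integral_le_of_norm_le_const (C := ε) fun u hu => ?_).trans ?_
      · rw [Set.uIoc_of_le (by linarith)] at hu
        refine hε u ⟨ha.trans hu.1.le, hu.2.trans hb⟩ _ hbm ?_
        rw [abs_le]; constructor <;> linarith [hu.1, hu.2]
      · rw [hab, add_sub_cancel_left, abs_of_nonneg hh]
    have i2 : |Real.exp (θ * h) - 1 - θ * h| ≤ (θ * h) ^ 2 :=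
      Real.abs_exp_sub_one_sub_id_le (by rwa [abs_of_nonneg (by positivity)])
    have e : (1 - Real.exp (θ * h)) * x ((j + 1 : ℕ) * h)
        + θ * ∫ u in (j * h : ℝ)..((j + 1 : ℕ) * h), x u
        = θ * ((∫ u in (j * h : ℝ)..((j + 1 : ℕ) * h), x u) - h * x ((j + 1 : ℕ) * h))
          - (Real.exp (θ * h) - 1 - θ * h) * x ((j + 1 : ℕ) * h) := by ring
    rw [e]
    refine (abs_sub _ _).trans ?_
    rw [abs_mul, abs_mul, abs_of_pos hθ]
    have := mul_le_mul i2 (hC _ hbm) (abs_nonneg _) (by positivity)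
    have := mul_le_mul_of_nonneg_left i1 hθ.le
    nlinarith
  have hsum : ∑ j ∈ Finset.range m, Real.exp (θ * (j * h)) *
        (w ((j + 1 : ℕ) * h') - w ((j : ℕ) * h')) - Real.exp (θ * (m * h)) * x (m * h)
      = ∑ j ∈ Finset.range m, Real.exp (θ * (j * h)) * ((1 - Real.exp (θ * h)) * x ((j + 1 : ℕ) * h)
          + θ * ∫ u in (j * h : ℝ)..((j + 1 : ℕ) * h), x u) := by
    have tele := Finset.sum_range_sub (fun j : ℕ => Real.exp (θ * (j * h)) * x (j * h)) m
    simp only [Nat.cast_zero, zero_mul, h0, mul_zero, sub_zero] at tele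
    rw [← tele, ← Finset.sum_sub_distrib]
    refine Finset.sum_congr rfl fun j _ => ?_
    rw [hinc]
    have : Real.exp (θ * ((j + 1 : ℕ) * h)) = Real.exp (θ * (j * h)) * Real.exp (θ * h) := by
      rw [← Real.exp_add]; congr 1; push_cast; ring
    rw [this]; ring
  rw [hsum]
  refine (Finset.abs_sum_le_sum_abs _ _).trans ?_
  have hD : 0 ≤ θ * ε + θ ^ 2 * h * C := by positivity
  calc _ ≤ ∑ j ∈ Finset.range m, Real.exp (θ * t) * (h * (θ * ε + θ ^ 2 * h * C)) := by
        refine Finset.sum_le_sum fun j hj => ?_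
        rw [abs_mul, Real.abs_exp]
        have hjm : (j : ℝ) ≤ m := by exact_mod_cast (Finset.mem_range.1 hj).le
        refine mul_le_mul (Real.exp_le_exp.2 ?_) (hrem j hj) (abs_nonneg _) (Real.exp_pos _).le
        exact mul_le_mul_of_nonneg_left ((mul_le_mul_of_nonneg_right hjm hh).trans hm) hθ.le
    _ = Real.exp (θ * t) * ((m * h) * (θ * ε + θ ^ 2 * h * C)) := by
        rw [Finset.sum_const, Finset.card_range, nsmul_eq_mul]; ring
    _ ≤ _ := by gcongr

theorem tendsto_convSum {θ : ℝ} (hθ : 0 < θ) {x : ℝ → ℝ} {w : ℝ≥0 → ℝ} (hx : Continuous x)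
    (hsde : ∀ s : ℝ≥0, x s = x 0 + (∫ u in (0 : ℝ)..s, -θ * x u) + (w s - w 0)) (h0 : x 0 = 0)
    {h : ℕ → ℝ≥0} (hpos : ∀ k, 0 < h k) (hlim : Tendsto h atTop (𝓝 0)) (t : ℝ≥0) :
    Tendsto (fun k => convSum θ w (h k) t) atTop (𝓝 (x t)) := by
  have hlim' : Tendsto (fun k => (h k : ℝ)) atTop (𝓝 0) :=
    (NNReal.continuous_coe.tendsto 0).comp hlim
  obtain ⟨C, hC⟩ := (isCompact_Icc (a := (0 : ℝ)) (b := t)).exists_bound_of_continuousOn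
    hx.continuousOn
  have huc := (isCompact_Icc (a := (0 : ℝ)) (b := t)).uniformContinuousOn_of_continuous
    hx.continuousOn
  rw [Metric.uniformContinuousOn_iff_le] at huc
  have hmain : Tendsto (fun k => ∑ j ∈ Finset.range ⌊t / h k⌋₊, Real.exp (θ * (j * h k)) *
      (w ((j + 1 : ℕ) * h k) - w ((j : ℕ) * h k))
      - Real.exp (θ * (⌊t / h k⌋₊ * h k)) * x (⌊t / h k⌋₊ * h k)) atTop (𝓝 0) := by
    rw [Metric.tendsto_nhds]
    intro δ hδ
    set A := Real.exp (θ * t) * (t * θ) with hA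
    have hA0 : 0 ≤ A := by positivity
    obtain ⟨ε, hε, hεA⟩ : ∃ ε > 0, A * ε < δ / 2 := by
      refine ⟨δ / (4 * (A + 1)), by positivity, ?_⟩
      rw [mul_div_assoc', div_lt_iff₀ (by positivity)]
      nlinarith
    obtain ⟨r, hr, hux⟩ := huc ε hε
    have l1 : Tendsto (fun k => A * θ * C * (h k : ℝ)) atTop (𝓝 0) := by
      simpa using hlim'.const_mul (A * θ * C)
    have l2 : Tendsto (fun k => θ * (h k : ℝ)) atTop (𝓝 0) := by
      simpa using hlim'.const_mul θ
    filter_upwards [hlim'.eventually_le_const hr, l1.eventually_lt_const (half_pos hδ),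
      l2.eventually_le_const one_pos] with k k1 k2 k3
    rw [Real.dist_eq, sub_zero]
    have hm : (⌊t / h k⌋₊ : ℝ) * h k ≤ t := by
      exact_mod_cast floor_div_mul_le_self t (hpos k)
    have := abs_sum_exp_mul_sub_le hθ (C := C) (ε := ε) (m := ⌊t / h k⌋₊) hx hsde h0 (h' := h k) rfl hm k3
      hC (fun s hs u hu hsu => hux s hs u hu (hsu.trans k1)) t.2
    refine this.trans_lt ?_
    have e : Real.exp (θ * t) * (t * (θ * ε + θ ^ 2 * h k * C)) = A * ε + A * θ * C * h k := by
      rw [hA]; ring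
    rw [e]; linarith
  have hfl : Tendsto (fun k => (⌊t / h k⌋₊ : ℝ) * h k) atTop (𝓝 t) := by
    have := (NNReal.continuous_coe.tendsto t).comp (tendsto_floor_div_mul hpos hlim t)
    simpa [Function.comp_def] using this
  have hc : Continuous fun s => Real.exp (θ * s) * x s := by fun_prop
  have := (hmain.add ((hc.tendsto _).comp hfl)).const_mul (Real.exp (-θ * t))
  rw [zero_add, ← mul_assoc, ← Real.exp_add] at this
  simp only [neg_mul, neg_add_cancel, Real.exp_zero, one_mul, Function.comp_apply,
    sub_add_cancel] at this
  refine this.congr fun k => ?_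
  rw [convSum, Finset.mul_sum]
  refine Finset.sum_congr rfl fun j _ => ?_
  rw [← mul_assoc, ← Real.exp_add]
  congr 2; ring

end PathwiseApproximation

/-! ### Covariance of the Riemann sums and its limit. -/

section Covariance

/-- The covariance function of the Ornstein-Uhlenbeck process started at `0`. -/
noncomputable def ouCov (θ : ℝ) (s t : ℝ≥0) : ℝ :=
  Real.exp (-θ * (s + t)) * (Real.exp (2 * θ * min s t) - 1) / (2 * θ)

/-- The covariance function of `convSum`. -/
noncomputable def convSumCov (θ : ℝ) (h s t : ℝ≥0) : ℝ :=
  ∑ j ∈ Finset.range (min ⌊s / h⌋₊ ⌊t / h⌋₊),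
    Real.exp (-θ * (s - j * h)) * Real.exp (-θ * (t - j * h)) * h

/-- A geometric sum of ratio `exp (2θh)`. The last factor tends to `1 / (2θ)`, the inverse of the
derivative of `exp (2θu)` at `0`. -/
theorem convSumCov_eq {θ : ℝ} (hθ : 0 < θ) {h : ℝ≥0} (hh : 0 < h) (s t : ℝ≥0) :
    convSumCov θ h s t = Real.exp (-θ * (s + t)) *
      (Real.exp (2 * θ * ((⌊min s t / h⌋₊ : ℝ≥0) * h : ℝ≥0)) - 1)
      * (h / (Real.exp (2 * θ * h) - 1)) := by
  have hm : min ⌊s / h⌋₊ ⌊t / h⌋₊ = ⌊min s t / h⌋₊ := by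
    rcases le_total s t with hst | hst
    · rw [min_eq_left hst, min_eq_left (Nat.floor_mono (by gcongr))]
    · rw [min_eq_right hst, min_eq_right (Nat.floor_mono (by gcongr))]
  have hne : Real.exp (2 * θ * h) ≠ 1 := by
    rw [Ne, Real.exp_eq_one_iff]
    have : (0 : ℝ) < h := hh
    positivity
  have e : ∀ j : ℕ, Real.exp (-θ * (s - j * h)) * Real.exp (-θ * (t - j * h)) * h
      = Real.exp (-θ * (s + t)) * h * Real.exp (2 * θ * h) ^ j := by
    intro j
    rw [← Real.exp_nat_mul, ← Real.exp_add, mul_right_comm, ← Real.exp_add]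
    congr 2; ring
  rw [convSumCov, hm, Finset.sum_congr rfl fun j _ => e j, ← Finset.mul_sum, geom_sum_eq hne]
  have e2 : Real.exp (2 * θ * h) ^ ⌊min s t / h⌋₊
      = Real.exp (2 * θ * ((⌊min s t / h⌋₊ : ℝ≥0) * h : ℝ≥0)) := by
    rw [← Real.exp_nat_mul]; congr 1; push_cast; ring
  rw [e2]; ring

theorem tendsto_convSumCov {θ : ℝ} (hθ : 0 < θ) {h : ℕ → ℝ≥0} (hpos : ∀ k, 0 < h k)
    (hlim : Tendsto h atTop (𝓝 0)) (s t : ℝ≥0) :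
    Tendsto (fun k => convSumCov θ (h k) s t) atTop (𝓝 (ouCov θ s t)) := by
  have hlim' : Tendsto (fun k => (h k : ℝ)) atTop (𝓝[≠] 0) :=
    tendsto_nhdsWithin_iff.2 ⟨(NNReal.continuous_coe.tendsto 0).comp hlim,
      Eventually.of_forall fun k => (NNReal.coe_pos.2 (hpos k)).ne'⟩
  have hd : HasDerivAt (fun u : ℝ => Real.exp (2 * θ * u)) (2 * θ) 0 := by
    simpa using ((hasDerivAt_id (0 : ℝ)).const_mul (2 * θ)).exp
  have h1 := (hd.tendsto_slope.comp hlim').inv₀ (by positivity)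
  have h2 : Tendsto (fun k => (h k : ℝ) / (Real.exp (2 * θ * h k) - 1)) atTop (𝓝 (2 * θ)⁻¹) := by
    refine h1.congr fun k => ?_
    simp [slope_def_field]
  have hc : Continuous fun u : ℝ≥0 => Real.exp (2 * θ * u) := by fun_prop
  have h3 := (hc.tendsto _).comp (tendsto_floor_div_mul hpos hlim (min s t))
  simp_rw [convSumCov_eq hθ (hpos _)]
  rw [ouCov, div_eq_mul_inv]
  exact ((h3.sub_const 1).const_mul _).mul h2

end Covariance

/-! ### The Ornstein-Uhlenbeck process is centered Gaussian. -/

section OrnsteinUhlenbeck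

variable {Ω : Type*} [MeasurableSpace Ω] {P : Measure Ω} {W X : ℝ≥0 → Ω → ℝ} {θ : ℝ}

theorem covariance_brownian_increments (hW : IsPreBrownianReal W P) (h : ℝ≥0) (i j : ℕ) :
    cov[fun ω => W ((i + 1 : ℕ) * h) ω - W ((i : ℕ) * h) ω,
      fun ω => W ((j + 1 : ℕ) * h) ω - W ((j : ℕ) * h) ω; P] = if i = j then (h : ℝ) else 0 := by
  have := hW.isGaussianProcess.isProbabilityMeasure
  have hm : ∀ t, MemLp (W t) 2 P := fun t => (hW.isGaussianProcess.hasGaussianLaw_eval t).memLp_two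
  have hmin : ∀ a b : ℕ, min ((a : ℝ≥0) * h) (b * h) = (min a b : ℕ) * h := fun a b => by
    rw [Nat.cast_min, min_mul_of_nonneg _ _ zero_le]
  rw [covariance_fun_sub_fun_sub (hm _) (hm _) (hm _) (hm _)]
  simp_rw [hW.covariance_fun_eval, hmin]
  push_cast
  rcases lt_trichotomy i j with hij | rfl | hij
  · rw [if_neg hij.ne, min_eq_left, min_eq_left, min_eq_left, min_eq_left]
    · ring
    all_goals norm_cast <;> omega
  · simp; ring
  · rw [if_neg hij.ne', min_eq_right, min_eq_right, min_eq_right, min_eq_right]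
    · ring
    all_goals norm_cast <;> omega

theorem isCenteredGaussian_convSum (hW : IsPreBrownianReal W P) (h : ℝ≥0) :
    IsCenteredGaussian (fun t ω => convSum θ (W · ω) h t) (convSumCov θ h) P := by
  have hP := hW.isGaussianProcess.isProbabilityMeasure
  have hm : ∀ t, MemLp (W t) 2 P := fun t => (hW.isGaussianProcess.hasGaussianLaw_eval t).memLp_two
  have hm' : ∀ (c : ℝ) (j : ℕ),
      MemLp (fun ω => c * (W ((j + 1 : ℕ) * h) ω - W ((j : ℕ) * h) ω)) 2 P :=
    fun c j => ((hm _).sub (hm _)).const_mul c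
  refine ⟨?_, fun t => ?_, fun s t => ?_⟩
  · classical
    refine hW.isGaussianProcess.of_isGaussianProcess fun t =>
      ⟨(Finset.range (⌊t / h⌋₊ + 1)).image fun j : ℕ => (j : ℝ≥0) * h,
      { toFun x := ∑ j : Fin ⌊t / h⌋₊, Real.exp (-θ * (t - j * h)) *
          (x ⟨(j + 1 : ℕ) * h, Finset.mem_image_of_mem (fun j : ℕ => (j : ℝ≥0) * h)
            (Finset.mem_range.2 (by omega))⟩
          - x ⟨(j : ℕ) * h, Finset.mem_image_of_mem (fun j : ℕ => (j : ℝ≥0) * h)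
            (Finset.mem_range.2 (by omega))⟩)
        map_add' x y := by
          rw [← Finset.sum_add_distrib]
          exact Finset.sum_congr rfl fun i _ => by simp only [Pi.add_apply]; ring
        map_smul' a x := by
          simp only [Pi.smul_apply, smul_eq_mul, Finset.mul_sum, RingHom.id_apply]
          exact Finset.sum_congr rfl fun i _ => by ring
        cont := by fun_prop }, fun ω => ?_⟩
    simp only [convSum, Finset.sum_range, ContinuousLinearMap.coe_mk', LinearMap.coe_mk,
      AddHom.coe_mk, Finset.restrict]
  · simp only [convSum]
    rw [integral_finsetSum _ fun j _ => (hm' _ j).integrable (by norm_num)]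
    refine Finset.sum_eq_zero fun j _ => ?_
    rw [integral_const_mul, integral_sub (hW.integrable_eval _) (hW.integrable_eval _),
      hW.integral_eval, hW.integral_eval, sub_zero, mul_zero]
  · simp only [convSum]
    rw [covariance_fun_sum_fun_sum' (fun j _ => hm' _ j) (fun j _ => hm' _ j)]
    simp_rw [covariance_const_mul_left, covariance_const_mul_right,
      covariance_brownian_increments hW]
    simp only [mul_ite, mul_zero, Finset.sum_ite_eq, convSumCov]
    rw [← Finset.sum_filter]
    refine Finset.sum_congr ?_ fun j _ => by ring
    ext j; simp

theorem IsOrnsteinUhlenbeck.isCenteredGaussian (hθ : 0 < θ) (hW : IsPreBrownianReal W P)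
    (hX : IsOrnsteinUhlenbeck θ W X P) : IsCenteredGaussian X (ouCov θ) P := by
  set h : ℕ → ℝ≥0 := fun k => 1 / ((k : ℝ≥0) + 1) with hh
  have hpos : ∀ k, 0 < h k := fun k => by positivity
  have hlim : Tendsto h atTop (𝓝 0) := tendsto_one_div_add_atTop_nhds_zero_nat
  refine IsCenteredGaussian.of_tendsto (fun k => isCenteredGaussian_convSum (θ := θ) hW (h k))
    (fun t => ?_) (tendsto_convSumCov hθ hpos hlim)
  filter_upwards [hX.cont, hX.init, hX.sde] with ω h1 h2 h3
  have := tendsto_convSum (x := fun s => X s.toNNReal ω) (w := fun t => W t ω) hθ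
    (h1.comp continuous_real_toNNReal) (fun s => by simpa using h3 s) (by simpa using h2)
    hpos hlim t
  simpa using this

end OrnsteinUhlenbeck

/-! ### Chernoff bound, Gaussian exponential moments and conditioning on the past. -/

section ExponentialMoments

variable {Ω : Type*} [MeasurableSpace Ω] {P : Measure Ω}

theorem measure_le_exp_mul_lintegral_exp {Z : Ω → ℝ} (hZ : AEMeasurable Z P) (a : ℝ) :
    P {ω | a ≤ Z ω} ≤ ENNReal.ofReal (Real.exp (-a)) * ∫⁻ ω, ENNReal.ofReal (Real.exp (Z ω)) ∂P := by
  have h := mul_meas_ge_le_lintegral₀ (μ := P) (f := fun ω => ENNReal.ofReal (Real.exp (Z ω)))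
    (by fun_prop) (ENNReal.ofReal (Real.exp a))
  have hs : {ω | ENNReal.ofReal (Real.exp a) ≤ ENNReal.ofReal (Real.exp (Z ω))} = {ω | a ≤ Z ω} := by
    ext ω
    simp [ENNReal.ofReal_le_ofReal_iff (Real.exp_pos _).le]
  rw [hs] at h
  calc P {ω | a ≤ Z ω}
      = ENNReal.ofReal (Real.exp (-a)) * (ENNReal.ofReal (Real.exp a) * P {ω | a ≤ Z ω}) := by
        rw [← mul_assoc, ← ENNReal.ofReal_mul (Real.exp_pos _).le, ← Real.exp_add]
        simp
    _ ≤ _ := by gcongr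

/-- The exact value for `s > 0` is `(1 - 2us)^(-1/2)`. Since `1 / (1 - y) = 1 + y / (1 - y) ≤ exp (y
/ (1 - y))`, it has a bound in exponential form, convenient for products of `n` factors. -/
theorem lintegral_exp_mul_sq_gaussianReal_le {s : ℝ≥0} {u : ℝ} (hu : 2 * (u * s) < 1) :
    ∫⁻ x, ENNReal.ofReal (Real.exp (u * x ^ 2)) ∂(gaussianReal 0 s) ≤
      ENNReal.ofReal (Real.exp (u * s / (1 - 2 * (u * s)))) := by
  rcases eq_or_ne s 0 with rfl | hs
  · simp [gaussianReal_zero_var, lintegral_dirac]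
  have hs0 : (0 : ℝ) < s := NNReal.coe_pos.2 (pos_of_ne_zero hs)
  have hd : 0 < 1 - 2 * (u * s) := by linarith
  set b : ℝ := 1 / (2 * s) - u with hb
  have hbe : b = (1 - 2 * (u * s)) / (2 * s) := by rw [hb]; field_simp
  have hb0 : 0 < b := by rw [hbe]; positivity
  have hpt : ∀ x, gaussianPDF 0 s x * ENNReal.ofReal (Real.exp (u * x ^ 2))
      = ENNReal.ofReal ((√(2 * Real.pi * s))⁻¹ * Real.exp (-b * x ^ 2)) := by
    intro x
    rw [gaussianPDF, ← ENNReal.ofReal_mul (gaussianPDFReal_nonneg _ _ _), gaussianPDFReal, mul_assoc,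
      ← Real.exp_add]
    congr 3
    rw [hb]; field_simp; ring
  rw [gaussianReal_of_var_ne_zero 0 hs, lintegral_withDensity_eq_lintegral_mul _
    (measurable_gaussianPDF 0 s) (by fun_prop)]
  simp only [Pi.mul_apply, hpt]
  rw [← ofReal_integral_eq_lintegral_ofReal ((integrable_exp_neg_mul_sq hb0).const_mul _)
    (Eventually.of_forall fun x => by positivity), integral_const_mul, integral_gaussian]
  refine ENNReal.ofReal_le_ofReal ?_
  have h1 : (√(2 * Real.pi * s))⁻¹ * √(Real.pi / b) = √(1 / (1 - 2 * (u * s))) := by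
    rw [← Real.sqrt_inv, ← Real.sqrt_mul (by positivity)]
    congr 1
    rw [hbe]
    have := Real.pi_pos
    field_simp
  rw [h1, Real.sqrt_le_left (Real.exp_pos _).le, ← Real.exp_nat_mul]
  have h2 : 1 / (1 - 2 * (u * s)) = (2 : ℕ) * (u * s / (1 - 2 * (u * s))) + 1 := by
    have := hd.ne'
    rw [div_eq_iff this, add_mul, one_mul, Nat.cast_two, mul_assoc, div_mul_cancel₀ _ this]
    ring
  rw [h2]
  exact Real.add_one_le_exp _

theorem lintegral_exp_linear_gaussianReal (s : ℝ≥0) (a : ℝ) :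
    ∫⁻ x, ENNReal.ofReal (Real.exp (a * x - a ^ 2 * s / 2)) ∂(gaussianReal 0 s) = 1 := by
  have hi := integrable_exp_mul_gaussianReal (μ := 0) (v := s) a
  have hm := congrFun (mgf_fun_id_gaussianReal (μ := 0) (v := s)) a
  rw [mgf] at hm
  simp_rw [sub_eq_add_neg, Real.exp_add]
  rw [← ofReal_integral_eq_lintegral_ofReal (hi.mul_const _)
    (Eventually.of_forall fun x => by positivity), integral_mul_const, hm, ← Real.exp_add]
  rw [← ENNReal.ofReal_one, ← Real.exp_zero]
  congr 2
  ring

/-- Tonelli on the product law of `(p, ξ)`: the noise is integrated with the past frozen, in place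
of a conditional expectation. -/
theorem lintegral_mul_le_of_indepFun {E F : Type*} [MeasurableSpace E] [MeasurableSpace F]
    [IsFiniteMeasure P] {p : Ω → E} {ξ : Ω → F} {ν : Measure F} (hp : AEMeasurable p P)
    (hξ : HasLaw ξ ν P) (hind : IndepFun p ξ P) {f : E → ENNReal} (hf : Measurable f)
    {g : E → F → ENNReal} (hg : Measurable (Function.uncurry g)) {C : ENNReal}
    (hC : ∀ e, ∫⁻ z, g e z ∂ν ≤ C) :
    ∫⁻ ω, f (p ω) * g (p ω) (ξ ω) ∂P ≤ (∫⁻ ω, f (p ω) ∂P) * C := by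
  have hm := hξ.aemeasurable
  have hν : IsFiniteMeasure ν := hξ.map_eq ▸ inferInstance
  have hfg : Measurable fun q : E × F => f q.1 * g q.1 q.2 := (hf.comp measurable_fst).mul hg
  have h1 : ∫⁻ ω, f (p ω) * g (p ω) (ξ ω) ∂P
      = ∫⁻ q : E × F, f q.1 * g q.1 q.2 ∂((P.map p).prod ν) := by
    rw [← hξ.map_eq, ← (indepFun_iff_map_prod_eq_prod_map_map hp hm).1 hind,
      lintegral_map' hfg.aemeasurable (hp.prodMk hm)]
  rw [h1, lintegral_prod _ hfg.aemeasurable,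
    ← lintegral_map' hf.aemeasurable hp, ← lintegral_mul_const _ hf]
  refine lintegral_mono fun e => ?_
  exact (lintegral_const_mul _ (hg.comp measurable_prodMk_left)).trans_le
    (mul_le_mul' le_rfl (hC e))

end ExponentialMoments

/-! ### Gaussian autoregression: exponential functionals and energy identity. -/

section Autoregression

variable {Ω : Type*} [MeasurableSpace Ω] {P : Measure Ω} {θ ρ : ℝ} {Y : ℕ → Ω → ℝ}

/-- `Y` is the autoregressive Gaussian process `Y₀ = 0`, `Y_{n+1} = ρ Y_n + ξ_n` whose stationary
variance is `1 / (2θ)`: each `ξ_n` is independent of the past `Y_0, …, Y_n` (written as a stopped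
sequence) and has variance `(1 - ρ²) / (2θ)`. -/
structure IsGaussianAR (θ ρ : ℝ) (Y : ℕ → Ω → ℝ) (P : Measure Ω) : Prop where
  measurable : ∀ n, Measurable (Y n)
  init : ∀ ω, Y 0 ω = 0
  noise : ∀ n, HasLaw (fun ω => Y (n + 1) ω - ρ * Y n ω)
    (gaussianReal 0 ((1 - ρ ^ 2) / (2 * θ)).toNNReal) P
  indep : ∀ n, IndepFun (fun ω i => Y (min i n) ω) (fun ω => Y (n + 1) ω - ρ * Y n ω) P
  law : ∀ n, ∃ w : ℝ≥0, θ * w ≤ 1 / 2 ∧ HasLaw (Y n) (gaussianReal 0 w) P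

theorem IsGaussianAR.lintegral_exp_sum_le [IsProbabilityMeasure P] (h : IsGaussianAR θ ρ Y P)
    {k : ℝ → ℝ → ℝ} (hk : Measurable (Function.uncurry k)) {C : ENNReal}
    (hC : ∀ y, ∫⁻ z, ENNReal.ofReal (Real.exp (k y z))
      ∂(gaussianReal 0 ((1 - ρ ^ 2) / (2 * θ)).toNNReal) ≤ C) (n : ℕ) :
    ∫⁻ ω, ENNReal.ofReal (Real.exp
      (∑ i ∈ Finset.range n, k (Y i ω) (Y (i + 1) ω - ρ * Y i ω))) ∂P ≤ C ^ n := by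
  induction n with
  | zero => simp
  | succ n ih =>
    -- Stopping the indices at `n` leaves the sum unchanged and exhibits it as a function of the
    -- stopped sequence, which `indep` makes independent of the next innovation.
    have hpast : ∀ ω, ∑ i ∈ Finset.range n, k (Y i ω) (Y (i + 1) ω - ρ * Y i ω)
        = ∑ i ∈ Finset.range n, k (Y (min i n) ω) (Y (min (i + 1) n) ω - ρ * Y (min i n) ω) := by
      refine fun ω => Finset.sum_congr rfl fun i hi => ?_
      rw [Finset.mem_range] at hi
      rw [min_eq_left hi.le, min_eq_left (Nat.succ_le_of_lt hi)]
    have hY := h.measurable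
    have hk' : ∀ (a b : (ℕ → ℝ) → ℝ), Measurable a → Measurable b →
        Measurable fun y => k (a y) (b y) := fun a b ha hb => hk.comp (ha.prodMk hb)
    have step := lintegral_mul_le_of_indepFun (P := P) (p := fun ω i => Y (min i n) ω)
      (Measurable.aemeasurable (by fun_prop)) (h.noise n) (h.indep n)
      (f := fun y => ENNReal.ofReal (Real.exp
        (∑ i ∈ Finset.range n, k (y i) (y (i + 1) - ρ * y i))))
      (by
        refine ENNReal.measurable_ofReal.comp (Real.measurable_exp.comp ?_)
        exact Finset.measurable_fun_sum _ fun i _ => hk' _ _ (by fun_prop) (by fun_prop))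
      (g := fun y z => ENNReal.ofReal (Real.exp (k (y n) z)))
      (by
        refine ENNReal.measurable_ofReal.comp (Real.measurable_exp.comp ?_)
        exact hk.comp (f := fun q : (ℕ → ℝ) × ℝ => (q.1 n, q.2)) (by fun_prop))
      (fun y => hC (y n))
    simp only [min_self, ← hpast] at step
    simp_rw [Finset.sum_range_succ, Real.exp_add, ENNReal.ofReal_mul (Real.exp_pos _).le]
    rw [pow_succ]
    exact step.trans (by gcongr)

/-- Energy identity of the autoregression. -/
theorem autoregression_energy (y : ℕ → ℝ) (h0 : y 0 = 0) (ρ : ℝ) (n : ℕ) :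
    (1 - ρ ^ 2) * ∑ i ∈ Finset.range n, y i ^ 2 + y n ^ 2
      = 2 * ρ * ∑ i ∈ Finset.range n, y i * (y (i + 1) - ρ * y i)
        + ∑ i ∈ Finset.range n, (y (i + 1) - ρ * y i) ^ 2 := by
  induction n with
  | zero => simp [h0]
  | succ n ih =>
    simp only [Finset.sum_range_succ]
    linear_combination ih

/-- The deterministic half of the concentration estimate: the energy identity converts control of
the martingale, of the squared noise and of the endpoint into control of the empirical second
moment. -/
theorem abs_mean_sq_sub_lt {g ρ δ : ℝ} {n : ℕ} {y : ℕ → ℝ} (hg : 0 < g) (hρ0 : 0 ≤ ρ) (hρ1 : ρ < 1)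
    (hn : 0 < n) (h0 : y 0 = 0) (hδ : 0 < δ) (hδg : δ * g ≤ 1 / 2)
    (hM : |∑ i ∈ Finset.range n, y i * (y (i + 1) - ρ * y i)|
      < δ * ((1 - ρ ^ 2) * g) / 2 * ∑ i ∈ Finset.range n, y i ^ 2 + δ * (n * (1 - ρ ^ 2)))
    (hQ : |∑ i ∈ Finset.range n, (y (i + 1) - ρ * y i) ^ 2 - g * (n * (1 - ρ ^ 2))|
      < δ * g * (n * (1 - ρ ^ 2)))
    (hy : y n ^ 2 < δ * (n * (1 - ρ ^ 2))) :
    |(∑ i ∈ Finset.range n, y (i + 1) ^ 2) / n - g| < δ * (2 * g ^ 2 + 2 * g + 7) := by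
  have hE := autoregression_energy y h0 ρ n
  have hS : ∑ i ∈ Finset.range n, y (i + 1) ^ 2 = ∑ i ∈ Finset.range n, y i ^ 2 + y n ^ 2 := by
    have := Finset.sum_range_succ (fun i => y i ^ 2) n
    rw [Finset.sum_range_succ' (fun i => y i ^ 2) n, h0] at this
    linarith
  rw [hS]
  set B := ∑ i ∈ Finset.range n, y i ^ 2
  set M := ∑ i ∈ Finset.range n, y i * (y (i + 1) - ρ * y i)
  set Q := ∑ i ∈ Finset.range n, (y (i + 1) - ρ * y i) ^ 2
  have hr : 0 < 1 - ρ ^ 2 := by nlinarith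
  have hr1 : 1 - ρ ^ 2 ≤ 1 := by nlinarith
  have hn' : (0 : ℝ) < n := by exact_mod_cast hn
  set N := (n : ℝ) * (1 - ρ ^ 2) with hN
  have hN0 : 0 < N := by positivity
  set A := (1 - ρ ^ 2) * B with hA
  have hAB : δ * ((1 - ρ ^ 2) * g) / 2 * B = δ * g / 2 * A := by rw [hA]; ring
  rw [hAB] at hM
  have hy0 : 0 ≤ y n ^ 2 := sq_nonneg _
  have hM2 : |2 * ρ * M| ≤ 2 * |M| := by
    rw [abs_mul, abs_of_nonneg (by positivity)]
    nlinarith [abs_nonneg M]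
  have h1 : |A - g * N| < δ * (g * A + (3 + g) * N) := by
    have e : A - g * N = 2 * ρ * M + (Q - g * N) - y n ^ 2 := by linarith
    rw [abs_lt] at hQ ⊢
    have := abs_le.1 hM2
    rw [e]
    constructor <;> nlinarith
  have h2 : |A - g * N| < 2 * δ * (g ^ 2 + g + 3) * N := by
    -- The martingale bound involves `A` itself; `δ g ≤ 1/2` lets half of `|A - g N|` be absorbed on
    -- the left.
    have hle : A ≤ g * N + |A - g * N| := by linarith [le_abs_self (A - g * N)]
    have : δ * g * A ≤ δ * g * (g * N) + 1 / 2 * |A - g * N| := by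
      have := mul_le_mul_of_nonneg_left hle (by positivity : 0 ≤ δ * g)
      nlinarith [abs_nonneg (A - g * N)]
    nlinarith
  have h3 : (B + y n ^ 2) / n - g = (A - g * N + (1 - ρ ^ 2) * y n ^ 2) / N := by
    rw [hA, hN]; field_simp; ring
  rw [h3, abs_div, abs_of_pos hN0, div_lt_iff₀ hN0]
  refine (abs_add_le _ _).trans_lt ?_
  rw [abs_of_nonneg (by positivity : 0 ≤ (1 - ρ ^ 2) * y n ^ 2)]
  have : (1 - ρ ^ 2) * y n ^ 2 ≤ y n ^ 2 := mul_le_of_le_one_left hy0 hr1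
  nlinarith

end Autoregression

/-! ### Exponential concentration of the empirical second moment. -/

section Deviation

variable {Ω : Type*} [MeasurableSpace Ω] {P : Measure Ω} [IsProbabilityMeasure P]
  {θ ρ : ℝ} {Y : ℕ → Ω → ℝ}

namespace IsGaussianAR

/-- Exponential martingale: each conditional factor has integral `1`. The random quadratic variation
stays inside the event and is absorbed later by `abs_mean_sq_sub_lt`. -/
theorem measure_martingale_ge (h : IsGaussianAR θ ρ Y P) (hθ : 0 < θ) (hρ : ρ ^ 2 ≤ 1) (a x : ℝ)
    (n : ℕ) :
    P {ω | x ≤ a * ∑ i ∈ Finset.range n, Y i ω * (Y (i + 1) ω - ρ * Y i ω)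
      - a ^ 2 * ((1 - ρ ^ 2) / (2 * θ)) / 2 * ∑ i ∈ Finset.range n, Y i ω ^ 2} ≤
      ENNReal.ofReal (Real.exp (-x)) := by
  have hY := h.measurable
  refine (measure_le_exp_mul_lintegral_exp (Measurable.aemeasurable (by fun_prop)) x).trans ?_
  have hs : 0 ≤ (1 - ρ ^ 2) / (2 * θ) := div_nonneg (by linarith) (by linarith)
  have := h.lintegral_exp_sum_le (k := fun y z => a * y * z
    - (a * y) ^ 2 * ((1 - ρ ^ 2) / (2 * θ)).toNNReal / 2) (C := 1) (by fun_prop)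
    (fun y => (lintegral_exp_linear_gaussianReal _ (a * y)).le) n
  rw [one_pow] at this
  calc _ ≤ ENNReal.ofReal (Real.exp (-x)) * 1 := by
        gcongr
        refine le_of_eq_of_le (lintegral_congr fun ω => ?_) this
        congr 2
        rw [Finset.mul_sum, Finset.mul_sum, ← Finset.sum_sub_distrib, Real.coe_toNNReal _ hs]
        exact Finset.sum_congr rfl fun i _ => by ring
    _ = _ := mul_one _

/-- A chi-square Chernoff bound, using `v / (1 - 2v) - v ≤ 4v²` for `|v| ≤ 1/4`. The sign of `v`
selects the tail. -/
theorem measure_noise_sq_ge (h : IsGaussianAR θ ρ Y P) (hθ : 0 < θ) (hρ : ρ ^ 2 < 1) {v x : ℝ}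
    (hv : |v| ≤ 1 / 4) (n : ℕ) :
    P {ω | x ≤ v * (∑ i ∈ Finset.range n, (Y (i + 1) ω - ρ * Y i ω) ^ 2
        - 1 / (2 * θ) * (n * (1 - ρ ^ 2)))} ≤
      ENNReal.ofReal (Real.exp (4 * v ^ 2 * n - x / ((1 - ρ ^ 2) / (2 * θ)))) := by
  have hY := h.measurable
  set s := (1 - ρ ^ 2) / (2 * θ) with hs
  have hs0 : 0 < s := div_pos (by linarith) (by linarith)
  have hv' := abs_le.1 hv
  have hset : {ω | x ≤ v * (∑ i ∈ Finset.range n, (Y (i + 1) ω - ρ * Y i ω) ^ 2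
        - 1 / (2 * θ) * (n * (1 - ρ ^ 2)))}
      = {ω | x / s + v * n ≤ ∑ i ∈ Finset.range n, v / s * (Y (i + 1) ω - ρ * Y i ω) ^ 2} := by
    ext ω
    have e : 1 / (2 * θ) * (n * (1 - ρ ^ 2)) = n * s := by rw [hs]; ring
    rw [Set.mem_ofPred_eq, Set.mem_ofPred_eq, ← Finset.mul_sum, e, div_add' _ _ _ hs0.ne',
      div_mul_eq_mul_div, div_le_div_iff_of_pos_right hs0]
    constructor <;> intro h <;> linarith
  rw [hset]
  refine (measure_le_exp_mul_lintegral_exp (Measurable.aemeasurable (by fun_prop)) _).trans ?_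
  have hvs : v / s * (s.toNNReal : ℝ) = v := by
    rw [Real.coe_toNNReal _ hs0.le]; field_simp
  have := h.lintegral_exp_sum_le (k := fun _ z => v / s * z ^ 2)
    (C := ENNReal.ofReal (Real.exp (v / (1 - 2 * v)))) (by fun_prop)
    (fun y => by
      have := lintegral_exp_mul_sq_gaussianReal_le (s := s.toNNReal) (u := v / s)
        (by rw [hvs]; linarith)
      rwa [hvs] at this) n
  calc _ ≤ ENNReal.ofReal (Real.exp (-(x / s + v * n)))
        * ENNReal.ofReal (Real.exp (v / (1 - 2 * v))) ^ n := by gcongr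
    _ = ENNReal.ofReal (Real.exp (n * (v / (1 - 2 * v) - v) - x / s)) := by
        rw [← ENNReal.ofReal_pow (Real.exp_pos _).le, ← Real.exp_nat_mul,
          ← ENNReal.ofReal_mul (Real.exp_pos _).le, ← Real.exp_add]
        congr 2; ring
    _ ≤ _ := by
        refine ENNReal.ofReal_le_ofReal (Real.exp_le_exp.2 ?_)
        have hd : 1 / 2 ≤ 1 - 2 * v := by linarith
        have : v / (1 - 2 * v) - v ≤ 4 * v ^ 2 := by
          have e : v / (1 - 2 * v) - v = 2 * v ^ 2 / (1 - 2 * v) := by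
            have : 1 - 2 * v ≠ 0 := by linarith
            rw [eq_div_iff this, sub_mul, div_mul_cancel₀ _ this]
            ring
          rw [e, div_le_iff₀ (by linarith)]
          nlinarith [sq_nonneg v]
        have := mul_le_mul_of_nonneg_left this (Nat.cast_nonneg (α := ℝ) n)
        linarith

omit [IsProbabilityMeasure P] in
theorem measure_sq_ge (h : IsGaussianAR θ ρ Y P) (hθ : 0 < θ) (x : ℝ) (n : ℕ) :
    P {ω | x ≤ Y n ω ^ 2} ≤ ENNReal.ofReal (2 * Real.exp (-(θ / 2 * x))) := by
  have hY := h.measurable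
  obtain ⟨w, hw, hlaw⟩ := h.law n
  have hset : {ω | x ≤ Y n ω ^ 2} = {ω | θ / 2 * x ≤ θ / 2 * Y n ω ^ 2} := by
    ext ω
    exact (mul_le_mul_iff_right₀ (half_pos hθ)).symm
  rw [hset]
  refine (measure_le_exp_mul_lintegral_exp (Measurable.aemeasurable (by fun_prop)) _).trans ?_
  -- With weight `θ/2`, `θ w ≤ 1/2` keeps the exponential moment below `exp (1/2) ≤ 2`, uniformly in
  -- `n`.
  have hu : 2 * (θ / 2 * w) < 1 := by linarith
  have h1 := lintegral_exp_mul_sq_gaussianReal_le hu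
  rw [← hlaw.map_eq, lintegral_map (by fun_prop) (hY n)] at h1
  rw [mul_comm (2 : ℝ), ENNReal.ofReal_mul (Real.exp_pos _).le]
  gcongr
  refine h1.trans (ENNReal.ofReal_le_ofReal ?_)
  have hle : θ / 2 * w / (1 - 2 * (θ / 2 * w)) ≤ 1 / 2 := by
    rw [div_le_iff₀ (by linarith)]; linarith
  calc _ ≤ Real.exp (1 / 2) := Real.exp_le_exp.2 hle
    _ ≤ 2 := by
      rw [← Real.le_log_iff_exp_le (by norm_num)]
      linarith [Real.log_two_gt_d9]

end IsGaussianAR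

/-- Exponential concentration of the empirical second moment of a Gaussian autoregression around
the stationary variance `1 / (2θ)`, with a rate depending only on `θ` and the precision. -/
theorem exists_measure_mean_sq_sub_ge_le {θ ε : ℝ} (hθ : 0 < θ) (hε : 0 < ε) :
    ∃ c : ℝ, 0 < c ∧ ∀ {Ω : Type*} [MeasurableSpace Ω] {P : Measure Ω} [IsProbabilityMeasure P]
      {ρ : ℝ} {Y : ℕ → Ω → ℝ}, 0 ≤ ρ → ρ ≤ 1 → IsGaussianAR θ ρ Y P → ∀ n : ℕ,
      P {ω | ε ≤ |(∑ i ∈ Finset.range n, Y (i + 1) ω ^ 2) / n - 1 / (2 * θ)|} ≤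
        ENNReal.ofReal (6 * Real.exp (-(c * (n * (1 - ρ ^ 2))))) := by
  set g : ℝ := 1 / (2 * θ) with hg
  have hg0 : 0 < g := by positivity
  -- `δ ≤ θ` gives the absorption condition `δ g ≤ 1/2`; the other bound makes the final error at
  -- most `ε`.
  set δ : ℝ := min θ (ε / (2 * g ^ 2 + 2 * g + 7)) with hδ
  have hδ0 : 0 < δ := by positivity
  have hδg : δ * g ≤ 1 / 2 := by
    calc δ * g ≤ θ * g := by gcongr; exact min_le_left _ _
      _ = 1 / 2 := by rw [hg]; field_simp
  have hδε : δ * (2 * g ^ 2 + 2 * g + 7) ≤ ε := by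
    rw [← le_div_iff₀ (by positivity)]; exact min_le_right _ _
  -- `v ≤ δ/8` makes the quadratic cost `4v²` at most half of the gain `vδ`.
  set v : ℝ := min (1 / 4) (δ / 8) with hv
  have hv0 : 0 < v := by positivity
  have hv4 : |v| ≤ 1 / 4 := by rw [abs_of_pos hv0]; exact min_le_left _ _
  have hv8 : v ≤ δ / 8 := min_le_right _ _
  -- The rates of the martingale, the squared noise and the endpoint.
  refine ⟨min (δ ^ 2) (min (v * δ / 2) (θ / 2 * δ)), by positivity, ?_⟩
  set c := min (δ ^ 2) (min (v * δ / 2) (θ / 2 * δ)) with hc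
  have hc1 : c ≤ δ ^ 2 := min_le_left _ _
  have hc2 : c ≤ v * δ / 2 := (min_le_right _ _).trans (min_le_left _ _)
  have hc3 : c ≤ θ / 2 * δ := (min_le_right _ _).trans (min_le_right _ _)
  have hc0 : 0 < c := by positivity
  intro Ω _ P _ ρ Y hρ0 hρ1 hAR n
  -- For `ρ = 1` or `n = 0` the right-hand side is `6`, above any probability.
  have htriv : (n : ℝ) * (1 - ρ ^ 2) = 0 → P {ω | ε ≤ |(∑ i ∈ Finset.range n,
      Y (i + 1) ω ^ 2) / n - g|} ≤ ENNReal.ofReal (6 * Real.exp (-(c * (n * (1 - ρ ^ 2))))) := by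
    intro h0
    rw [h0]
    refine prob_le_one.trans ?_
    simp
  rcases eq_or_lt_of_le hρ1 with rfl | hρ1
  · exact htriv (by simp)
  rcases Nat.eq_zero_or_pos n with rfl | hn
  · exact htriv (by simp)
  have hr : ρ ^ 2 < 1 := by nlinarith
  have hr0 : 0 ≤ ρ ^ 2 := sq_nonneg ρ
  set N : ℝ := n * (1 - ρ ^ 2) with hN
  have hn' : (0 : ℝ) < n := by exact_mod_cast hn
  have hN0 : 0 < N := mul_pos hn' (by linarith)
  have hNn : N ≤ n := by rw [hN]; nlinarith
  set M : Ω → ℝ := fun ω => ∑ i ∈ Finset.range n, Y i ω * (Y (i + 1) ω - ρ * Y i ω) with hM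
  set B : Ω → ℝ := fun ω => ∑ i ∈ Finset.range n, Y i ω ^ 2 with hB
  set Q : Ω → ℝ := fun ω => ∑ i ∈ Finset.range n, (Y (i + 1) ω - ρ * Y i ω) ^ 2 with hQ
  have b1 : ∀ a : ℝ, P {ω | δ ^ 2 * N ≤ a * M ω
      - a ^ 2 * ((1 - ρ ^ 2) / (2 * θ)) / 2 * B ω} ≤ ENNReal.ofReal (Real.exp (-(c * N))) := by
    intro a
    refine (hAR.measure_martingale_ge hθ hr.le a (δ ^ 2 * N) n).trans ?_
    gcongr
  have b2 : ∀ u : ℝ, u = v ∨ u = -v → P {ω | v * (δ * g * N) ≤ u * (Q ω - g * N)} ≤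
      ENNReal.ofReal (Real.exp (-(c * N))) := by
    intro u hu
    have hu4 : |u| ≤ 1 / 4 := by rcases hu with rfl | rfl <;> simpa using hv4
    have husq : u ^ 2 = v ^ 2 := by rcases hu with rfl | rfl <;> ring
    refine (hAR.measure_noise_sq_ge hθ hr hu4 n).trans ?_
    refine ENNReal.ofReal_le_ofReal (Real.exp_le_exp.2 ?_)
    have e : v * (δ * g * N) / ((1 - ρ ^ 2) / (2 * θ)) = v * δ * n := by
      have : 1 - ρ ^ 2 ≠ 0 := by linarith
      rw [hg, hN]; field_simp
    rw [e, husq]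
    have i1 : 4 * v ^ 2 * n ≤ v * δ / 2 * n := by
      refine mul_le_mul_of_nonneg_right ?_ hn'.le
      nlinarith
    have i2 : c * N ≤ v * δ / 2 * n := mul_le_mul hc2 hNn hN0.le (by positivity)
    linarith
  have b3 : P {ω | δ * N ≤ Y n ω ^ 2} ≤ ENNReal.ofReal (2 * Real.exp (-(c * N))) := by
    refine (hAR.measure_sq_ge hθ (δ * N) n).trans ?_
    refine ENNReal.ofReal_le_ofReal ?_
    have := mul_le_mul_of_nonneg_right hc3 hN0.le
    have : Real.exp (-(θ / 2 * (δ * N))) ≤ Real.exp (-(c * N)) :=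
      Real.exp_le_exp.2 (by linarith)
    linarith
  -- Two tails for the martingale, two for the noise, and an endpoint event costing twice as much:
  -- hence the factor `6`.
  have hsub : {ω | ε ≤ |(∑ i ∈ Finset.range n, Y (i + 1) ω ^ 2) / n - g|} ⊆
      ({ω | δ ^ 2 * N ≤ δ * M ω - δ ^ 2 * ((1 - ρ ^ 2) / (2 * θ)) / 2 * B ω} ∪
       {ω | δ ^ 2 * N ≤ -δ * M ω - (-δ) ^ 2 * ((1 - ρ ^ 2) / (2 * θ)) / 2 * B ω}) ∪
      ({ω | v * (δ * g * N) ≤ v * (Q ω - g * N)} ∪ {ω | v * (δ * g * N) ≤ -v * (Q ω - g * N)}) ∪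
      {ω | δ * N ≤ Y n ω ^ 2} := by
    intro ω hω
    by_contra hcon
    simp only [Set.mem_union, Set.mem_ofPred_eq, not_or, not_le] at hcon
    obtain ⟨⟨⟨m1, m2⟩, q1, q2⟩, y1⟩ := hcon
    have e : (1 - ρ ^ 2) / (2 * θ) = (1 - ρ ^ 2) * g := by rw [hg]; ring
    rw [e] at m1 m2
    refine absurd hω (not_le.2 (lt_of_lt_of_le ?_ hδε))
    refine abs_mean_sq_sub_lt (y := fun i => Y i ω) hg0 hρ0 hρ1 hn (hAR.init ω) hδ0 hδg
      (abs_lt.2 ⟨?_, ?_⟩) (abs_lt.2 ⟨?_, ?_⟩) y1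
    · change -(δ * ((1 - ρ ^ 2) * g) / 2 * B ω + δ * N) < M ω
      refine lt_of_mul_lt_mul_left ?_ hδ0.le
      nlinarith
    · change M ω < δ * ((1 - ρ ^ 2) * g) / 2 * B ω + δ * N
      refine lt_of_mul_lt_mul_left ?_ hδ0.le
      nlinarith
    · change -(δ * g * N) < Q ω - g * N
      refine lt_of_mul_lt_mul_left ?_ hv0.le
      linarith
    · exact lt_of_mul_lt_mul_left q1 hv0.le
  set E : ℝ := Real.exp (-(c * N)) with hE
  have hE0 : 0 ≤ E := (Real.exp_pos _).le
  calc _ ≤ _ := measure_mono hsub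
    _ ≤ ((ENNReal.ofReal E + ENNReal.ofReal E) + (ENNReal.ofReal E + ENNReal.ofReal E))
        + ENNReal.ofReal (2 * E) := by
      refine (measure_union_le _ _).trans (add_le_add ((measure_union_le _ _).trans (add_le_add
        ((measure_union_le _ _).trans (add_le_add (b1 _) (b1 _)))
        ((measure_union_le _ _).trans (add_le_add (b2 _ (.inl rfl)) (b2 _ (.inr rfl)))))) b3)
    _ = ENNReal.ofReal (6 * E) := by
      rw [← ENNReal.ofReal_add hE0 hE0, ← ENNReal.ofReal_add (by positivity) (by positivity),
        ← ENNReal.ofReal_add (by positivity) (by positivity)]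
      congr 1; ring

end Deviation

/-! ### A measurable version with continuous paths. -/

section Modification

variable {Ω : Type*} [MeasurableSpace Ω] {P : Measure Ω}

/-- On a measurable set of full measure the path is continuous and agrees with measurable versions
at countably many dense times; off it the path is set to `0`. Continuity carries measurability to
every time. -/
theorem exists_measurable_continuous_modification {X : ℝ≥0 → Ω → ℝ}
    (hm : ∀ t, AEMeasurable (X t) P) (hc : ∀ᵐ ω ∂P, Continuous fun t => X t ω)
    (h0 : ∀ᵐ ω ∂P, X 0 ω = 0) :
    ∃ X' : ℝ≥0 → Ω → ℝ, (∀ t, Measurable (X' t)) ∧ (∀ ω, Continuous fun t => X' t ω) ∧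
      (∀ ω, X' 0 ω = 0) ∧ ∀ᵐ ω ∂P, ∀ t, X' t ω = X t ω := by
  let q := TopologicalSpace.denseSeq ℝ≥0
  have hq : ∀ᵐ ω ∂P, (Continuous fun t => X t ω) ∧ X 0 ω = 0 ∧
      ∀ n, X (q n) ω = (hm (q n)).mk _ ω := by
    filter_upwards [hc, h0, ae_all_iff.2 fun n => (hm (q n)).ae_eq_mk] with ω h1 h2 h3
    exact ⟨h1, h2, h3⟩
  obtain ⟨G, hGae, hGm, hG⟩ := hq.exists_measurable_mem
  refine ⟨fun t => G.indicator (X t), fun t => ?_, fun ω => ?_, fun ω => ?_, ?_⟩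
  · obtain ⟨u, hu, hut⟩ := mem_closure_iff_seq_limit.1
      (TopologicalSpace.denseRange_denseSeq ℝ≥0 t)
    refine measurable_of_tendsto_metrizable (f := fun k => G.indicator (X (u k))) (fun k => ?_) ?_
    · obtain ⟨n, hn⟩ := hu k
      have : G.indicator (X (u k)) = G.indicator ((hm (q n)).mk _) := by
        rw [← hn]
        exact Set.indicator_congr fun ω hω => (hG ω hω).2.2 n
      rw [this]
      exact (hm (q n)).measurable_mk.indicator hGm
    · rw [tendsto_pi_nhds]
      intro ω
      by_cases hω : ω ∈ G
      · simp only [Set.indicator_of_mem hω]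
        exact ((hG ω hω).1.tendsto t).comp hut
      · simp only [Set.indicator_of_notMem hω]
        exact tendsto_const_nhds
  · by_cases hω : ω ∈ G
    · simp only [Set.indicator_of_mem hω]
      exact (hG ω hω).1
    · simp only [Set.indicator_of_notMem hω]
      exact continuous_const
  · by_cases hω : ω ∈ G
    · simp only [Set.indicator_of_mem hω]
      exact (hG ω hω).2.1
    · simp only [Set.indicator_of_notMem hω]
  · filter_upwards [hGae] with ω hω t
    exact Set.indicator_of_mem hω _

end Modification

/-! ### Algebra of the Ornstein-Uhlenbeck covariance. -/

section OUCovariance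

theorem ouCov_comm (θ : ℝ) (s t : ℝ≥0) : ouCov θ s t = ouCov θ t s := by
  rw [ouCov, ouCov, min_comm, add_comm]

theorem ouCov_of_le (θ : ℝ) {s t : ℝ≥0} (h : s ≤ t) :
    ouCov θ s t = Real.exp (-θ * (t - s)) * ((1 - Real.exp (-(2 * θ * s))) / (2 * θ)) := by
  have e1 : Real.exp (-θ * (s + t)) * Real.exp (2 * θ * s) = Real.exp (-θ * (t - s)) := by
    rw [← Real.exp_add]; congr 1; ring
  have e2 : Real.exp (-θ * (t - s)) * Real.exp (-(2 * θ * s)) = Real.exp (-θ * (s + t)) := by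
    rw [← Real.exp_add]; congr 1; ring
  rw [ouCov, min_eq_left h, mul_sub, e1, ← e2]
  ring

theorem ouCov_self (θ : ℝ) (t : ℝ≥0) :
    ouCov θ t t = (1 - Real.exp (-(2 * θ * t))) / (2 * θ) := by
  rw [ouCov_of_le θ le_rfl]; simp

theorem ouCov_self_le {θ : ℝ} (hθ : 0 < θ) (t : ℝ≥0) : ouCov θ t t ≤ 1 / (2 * θ) := by
  rw [ouCov_self]
  have := Real.exp_pos (-(2 * θ * t))
  gcongr
  linarith

/-- Markov property at the level of covariances: `X u - exp (-θ (u - t)) X t` is uncorrelated with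
`X s` for `s ≤ t`. -/
theorem ouCov_mul_exp {θ : ℝ} {s t u : ℝ≥0} (hst : s ≤ t) (htu : t ≤ u) :
    ouCov θ s u = Real.exp (-θ * (u - t)) * ouCov θ s t := by
  rw [ouCov_of_le θ hst, ouCov_of_le θ (hst.trans htu), ← mul_assoc, ← Real.exp_add]
  congr 2; ring

theorem ouCov_noise (θ : ℝ) (s t : ℝ≥0) :
    ouCov θ t t - Real.exp (-θ * (t - s)) ^ 2 * ouCov θ s s
      = (1 - Real.exp (-θ * (t - s)) ^ 2) / (2 * θ) := by
  have e : Real.exp (-(2 * θ * t)) = Real.exp (-θ * (t - s)) ^ 2 * Real.exp (-(2 * θ * s)) := by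
    rw [← Real.exp_nat_mul, ← Real.exp_add]; congr 1; push_cast; ring
  rw [ouCov_self, ouCov_self, e]
  ring

end OUCovariance

/-! ### The sampled process as an autoregression; variances of increments and sums. -/

section OUGaussian

variable {Ω : Type*} [MeasurableSpace Ω] {P : Measure Ω} {θ : ℝ} {X : ℝ≥0 → Ω → ℝ}

theorem IsCenteredGaussian.isGaussianAR (hX : IsCenteredGaussian X (ouCov θ) P) (hθ : 0 < θ)
    (hm : ∀ t, Measurable (X t)) (h0 : ∀ ω, X 0 ω = 0) (δ : ℝ≥0) :
    IsGaussianAR θ (Real.exp (-θ * δ)) (fun n => X ((n : ℝ≥0) * δ)) P := by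
  have hP := hX.gaussian.isProbabilityMeasure
  have hle : ∀ n : ℕ, (n : ℝ≥0) * δ ≤ ((n + 1 : ℕ) : ℝ≥0) * δ := fun n => by
    gcongr; omega
  have hd : ∀ n : ℕ, ((((n + 1 : ℕ) : ℝ≥0) * δ : ℝ≥0) : ℝ) - ((n : ℝ≥0) * δ : ℝ≥0) = δ := fun n => by
    push_cast; ring
  refine ⟨fun n => hm _, fun ω => by simpa using h0 ω, fun n => ?_, fun n => ?_, fun n => ?_⟩
  · have h := hX.hasLaw_linear 1 (-Real.exp (-θ * δ)) (((n + 1 : ℕ) : ℝ≥0) * δ) ((n : ℝ≥0) * δ)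
    have e := ouCov_noise θ ((n : ℝ≥0) * δ) (((n + 1 : ℕ) : ℝ≥0) * δ)
    have e2 := ouCov_mul_exp (θ := θ) le_rfl (hle n)
    rw [hd] at e e2
    rw [ouCov_comm θ (((n + 1 : ℕ) : ℝ≥0) * δ) ((n : ℝ≥0) * δ), e2] at h
    convert h using 2
    · ring
    · congr 1
      rw [← e]; ring
  -- The past and the innovation are jointly Gaussian, so vanishing covariance gives independence.
  · have hjoint : IsGaussianProcess (Sum.elim (fun i : ℕ => X (((min i n : ℕ) : ℝ≥0) * δ))
        (fun (_ : Unit) ω => X (((n + 1 : ℕ) : ℝ≥0) * δ) ω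
          - Real.exp (-θ * δ) * X ((n : ℝ≥0) * δ) ω)) P := by
      classical
      refine hX.gaussian.of_isGaussianProcess ?_
      rintro (i | _)
      · exact ⟨{((min i n : ℕ) : ℝ≥0) * δ},
          { toFun x := x ⟨((min i n : ℕ) : ℝ≥0) * δ, by simp⟩
            map_add' x y := by simp
            map_smul' c x := by simp }, by simp⟩
      · exact ⟨{((n + 1 : ℕ) : ℝ≥0) * δ, (n : ℝ≥0) * δ},
          { toFun x := x ⟨((n + 1 : ℕ) : ℝ≥0) * δ, by simp⟩
              - Real.exp (-θ * δ) * x ⟨(n : ℝ≥0) * δ, by simp⟩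
            map_add' x y := by simp only [Pi.add_apply]; ring
            map_smul' c x := by simp only [Pi.smul_apply, smul_eq_mul, RingHom.id_apply]; ring },
          fun ω => rfl⟩
    have hind := hjoint.indepFun_of_covariance_eq_zero (fun i => (hm _).aemeasurable)
      (fun _ => by fun_prop) (fun i _ => ?_)
    · exact hind.comp (φ := id) (ψ := fun f : Unit → ℝ => f ()) measurable_id (by fun_prop)
    · have hi : ((min i n : ℕ) : ℝ≥0) * δ ≤ (n : ℝ≥0) * δ := by
        gcongr; exact min_le_right _ _
      rw [covariance_fun_sub_right (hX.memLp_two _) (hX.memLp_two _)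
        ((hX.memLp_two _).const_mul _), covariance_const_mul_right]
      change cov[X _, X _; P] - _ * cov[X _, X _; P] = 0
      rw [hX.cov, hX.cov, ouCov_mul_exp hi (hle n), hd, sub_self]
  · have h := hX.hasLaw_linear 1 0 ((n : ℝ≥0) * δ) ((n : ℝ≥0) * δ)
    simp only [one_mul, zero_mul, add_zero, one_pow, mul_zero] at h
    refine ⟨_, ?_, h⟩
    have : max (ouCov θ (n * δ) (n * δ)) 0 ≤ 1 / (2 * θ) :=
      max_le (ouCov_self_le hθ _) (by positivity)
    rw [Real.coe_toNNReal']
    simp only [ne_eq, OfNat.ofNat_ne_zero, not_false_eq_true, zero_pow, zero_mul, add_zero]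
    calc θ * _ ≤ θ * (1 / (2 * θ)) := by gcongr
      _ = 1 / 2 := by field_simp

/-- With `q = exp (-θ (t - s))`, the variance is `(1 - q)² ouCov θ s s + (1 - q²)/(2θ)`, at most `(1
- q)/θ ≤ t - s`. -/
theorem IsCenteredGaussian.exists_hasLaw_sub (hX : IsCenteredGaussian X (ouCov θ) P) (hθ : 0 < θ)
    {s t : ℝ≥0} (hst : s ≤ t) :
    ∃ w : ℝ≥0, (w : ℝ) ≤ t - s ∧ HasLaw (fun ω => X t ω - X s ω) (gaussianReal 0 w) P := by
  have h := hX.hasLaw_linear 1 (-1) t s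
  have hst' : (s : ℝ) ≤ t := hst
  refine ⟨_, ?_, by simpa [← sub_eq_add_neg] using h⟩
  rw [ouCov_comm θ t s, Real.coe_toNNReal']
  refine max_le ?_ (by linarith)
  have e := ouCov_noise θ s t
  have e2 := ouCov_mul_exp (θ := θ) le_rfl hst
  have hs := ouCov_self_le hθ s
  set q := Real.exp (-θ * (t - s)) with hq
  have hq1 : 1 - θ * (t - s) ≤ q := by
    have := Real.add_one_le_exp (-θ * (t - s)); rw [hq]; linarith
  have h2 : (1 - q) ^ 2 * ouCov θ s s ≤ (1 - q) ^ 2 * (1 / (2 * θ)) := by gcongr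
  have h3 : (1 - q) ^ 2 * (1 / (2 * θ)) + (1 - q ^ 2) / (2 * θ) = (1 - q) / θ := by
    field_simp; ring
  have h4 : (1 - q) / θ ≤ t - s := by
    rw [div_le_iff₀ hθ]; linarith
  rw [e2]
  nlinarith

theorem IsCenteredGaussian.exists_hasLaw_add (hX : IsCenteredGaussian X (ouCov θ) P) (hθ : 0 < θ)
    (s t : ℝ≥0) :
    ∃ w : ℝ≥0, (w : ℝ) ≤ 2 / θ ∧ HasLaw (fun ω => X t ω + X s ω) (gaussianReal 0 w) P := by
  have h := hX.hasLaw_linear 1 1 t s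
  refine ⟨_, ?_, by simpa using h⟩
  rw [ouCov_comm θ t s, Real.coe_toNNReal']
  refine max_le ?_ (by positivity)
  have h1 := ouCov_self_le hθ s
  have h2 := ouCov_self_le hθ t
  have h3 : ouCov θ s t ≤ 1 / (2 * θ) := by
    wlog hst : s ≤ t generalizing s t
    · rw [ouCov_comm]
      exact this t s (by simpa using hX.hasLaw_linear 1 1 s t) h2 h1 (le_of_not_ge hst)
    rw [ouCov_mul_exp le_rfl hst]
    have hst' : (s : ℝ) ≤ t := hst
    have hq : Real.exp (-θ * (t - s)) ≤ 1 := Real.exp_le_one_iff.2 (by nlinarith)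
    calc _ ≤ Real.exp (-θ * (t - s)) * (1 / (2 * θ)) := by gcongr
      _ ≤ 1 * (1 / (2 * θ)) := by gcongr
      _ = _ := one_mul _
  have e : 2 / θ = 4 * (1 / (2 * θ)) := by field_simp; norm_num
  rw [e]
  linarith

end OUGaussian

/-! ### Borel-Cantelli and summability from the step-size conditions. -/

section Convergence

variable {Ω : Type*} [MeasurableSpace Ω] {P : Measure Ω}

theorem ae_tendsto_of_summable_measure {Z : ℕ → Ω → ℝ} {l : ℝ}
    (h : ∀ ε > 0, ∃ b : ℕ → ℝ, Summable b ∧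
      ∀ᶠ n in atTop, P {ω | ε ≤ |Z n ω - l|} ≤ ENNReal.ofReal (b n)) :
    ∀ᵐ ω ∂P, Tendsto (fun n => Z n ω) atTop (𝓝 l) := by
  have key : ∀ k : ℕ, ∀ᵐ ω ∂P, ∀ᶠ n in atTop, |Z n ω - l| < 1 / ((k : ℝ) + 1) := by
    intro k
    obtain ⟨b, hb, hle⟩ := h (1 / ((k : ℝ) + 1)) (by positivity)
    obtain ⟨m, hm⟩ := eventually_atTop.1 hle
    have hsum : ∑' n, P {ω | 1 / ((k : ℝ) + 1) ≤ |Z (n + m) ω - l|} ≠ ⊤ := by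
      have hb' : Summable fun n => b (n + m) := (summable_nat_add_iff m).2 hb
      refine ne_top_of_le_ne_top hb'.tsum_ofReal_ne_top (ENNReal.tsum_le_tsum fun n => ?_)
      exact hm _ (by omega)
    filter_upwards [ae_eventually_notMem hsum] with ω hω
    obtain ⟨r, hr⟩ := eventually_atTop.1 hω
    refine eventually_atTop.2 ⟨r + m, fun n hn => ?_⟩
    have := hr (n - m) (by omega)
    rw [Nat.sub_add_cancel (by omega)] at this
    exact not_le.1 this
  filter_upwards [ae_all_iff.2 key] with ω hω
  rw [Metric.tendsto_nhds]
  intro ε hε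
  obtain ⟨k, hk⟩ := exists_nat_one_div_lt hε
  filter_upwards [hω k] with n hn
  rw [Real.dist_eq]
  exact hn.trans hk

theorem tendsto_one_div_two_mul {u : ℕ → ℝ} {θ : ℝ} (hθ : 0 < θ)
    (hu : Tendsto u atTop (𝓝 (1 / (2 * θ)))) : Tendsto (fun n => 1 / (2 * u n)) atTop (𝓝 θ) := by
  have h := (tendsto_const_nhds (x := (1 : ℝ))).div (hu.const_mul 2) (by positivity)
  have e : 1 / (2 * (1 / (2 * θ))) = θ := by field_simp
  rwa [e] at h

theorem exists_abs_sub_lt_imp_abs_one_div_sub_lt {θ ε : ℝ} (hθ : 0 < θ) (hε : 0 < ε) :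
    ∃ δ > 0, ∀ u : ℝ, |u - 1 / (2 * θ)| < δ → |1 / (2 * u) - θ| < ε := by
  have hc : ContinuousAt (fun u : ℝ => 1 / (2 * u)) (1 / (2 * θ)) :=
    continuousAt_const.div (continuousAt_const.mul continuousAt_id) (by positivity)
  obtain ⟨δ, hδ, h⟩ := Metric.continuousAt_iff.1 hc ε hε
  refine ⟨δ, hδ, fun u hu => ?_⟩
  have := h (x := u) (by rwa [Real.dist_eq])
  have e : 1 / (2 * (1 / (2 * θ))) = θ := by field_simp
  rwa [Real.dist_eq, e] at this

/-- Eventually `Δ_n ≥ n^(-1/η)`, so `nΔ_n ≥ n^(1 - 1/η)`, a positive power; a stretched exponential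
beats `n^(-2)`. -/
theorem summable_exp_neg_mul_of_tendsto {η c : ℝ} {Δ : ℕ → ℝ} (hc : 0 < c)
    (hη : 1 < η) (hΔ : ∀ n, 0 ≤ Δ n)
    (h : Tendsto (fun n : ℕ => (n : ℝ) * Δ n ^ η) atTop atTop) :
    Summable fun n => Real.exp (-(c * (n * Δ n))) := by
  have hη0 : 0 < η := by linarith
  set α : ℝ := 1 - 1 / η with hα
  have hα0 : 0 < α := by
    rw [hα, sub_pos, div_lt_one hη0]; exact hη
  have hpow : Tendsto (fun n : ℕ => (n : ℝ) ^ α) atTop atTop :=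
    (tendsto_rpow_atTop hα0).comp tendsto_natCast_atTop_atTop
  have hlow : ∀ᶠ n : ℕ in atTop, (n : ℝ) ^ α ≤ n * Δ n := by
    filter_upwards [h.eventually_ge_atTop 1, eventually_gt_atTop 0] with n hn hn0
    have hn' : (0 : ℝ) < n := by exact_mod_cast hn0
    have h1 : 1 / (n : ℝ) ≤ Δ n ^ η := by
      rw [div_le_iff₀ hn']; linarith
    have h2 : (1 / (n : ℝ)) ^ (1 / η) ≤ Δ n := by
      have := Real.rpow_le_rpow (by positivity) h1 (by positivity : 0 ≤ 1 / η)
      rwa [← Real.rpow_mul (hΔ n), mul_one_div_cancel hη0.ne', Real.rpow_one] at this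
    rw [hα, Real.rpow_sub hn', Real.rpow_one, div_eq_mul_one_div]
    rw [Real.div_rpow zero_le_one hn'.le, Real.one_rpow] at h2
    exact mul_le_mul_of_nonneg_left h2 hn'.le
  have hO : (fun n : ℕ => Real.exp (-(c * (n : ℝ) ^ α))) =O[atTop] fun n : ℕ => (n : ℝ) ^ (-2 : ℝ) := by
    have h1 := (isLittleO_exp_neg_mul_rpow_atTop hc (-2 / α)).isBigO.comp_tendsto hpow
    refine h1.congr' (Eventually.of_forall fun n => by simp) ?_
    filter_upwards [eventually_gt_atTop 0] with n hn0
    have hn' : (0 : ℝ) ≤ n := by positivity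
    simp only [Function.comp_apply]
    rw [← Real.rpow_mul hn', mul_div_cancel₀ _ hα0.ne']
  have hs : Summable fun n : ℕ => Real.exp (-(c * (n : ℝ) ^ α)) :=
    summable_of_isBigO_nat (Real.summable_nat_rpow.2 (by norm_num)) hO
  refine Summable.of_norm_bounded_eventually_nat hs ?_
  filter_upwards [hlow] with n hn
  rw [Real.norm_eq_abs, Real.abs_exp]
  gcongr

/-- Eventually `Δ_n² ≤ n^(-2/η)`, and `2/η > 1`. -/
theorem summable_sq_of_tendsto {η : ℝ} {Δ : ℕ → ℝ} (hη : 1 < η) (hη2 : η < 2)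
    (hΔ : ∀ n, 0 ≤ Δ n) (h : Tendsto (fun n : ℕ => (n : ℝ) * Δ n ^ η) atTop (𝓝 0)) :
    Summable fun n => Δ n ^ 2 := by
  have hη0 : 0 < η := by linarith
  have hs : Summable fun n : ℕ => (n : ℝ) ^ (-(2 / η)) := by
    refine Real.summable_nat_rpow.2 ?_
    rw [neg_lt_neg_iff, lt_div_iff₀ hη0]; linarith
  refine Summable.of_norm_bounded_eventually_nat hs ?_
  filter_upwards [h.eventually_le_const one_pos, eventually_gt_atTop 0] with n hn hn0
  have hn' : (0 : ℝ) < n := by exact_mod_cast hn0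
  have h1 : Δ n ^ η ≤ (n : ℝ)⁻¹ := by
    rw [← one_div, le_div_iff₀ hn']; linarith
  have h2 := Real.rpow_le_rpow (Real.rpow_nonneg (hΔ n) _) h1 (by positivity : 0 ≤ 2 / η)
  rw [← Real.rpow_mul (hΔ n), mul_div_cancel₀ _ hη0.ne', Real.inv_rpow hn'.le,
    ← Real.rpow_neg hn'.le] at h2
  rw [Real.norm_of_nonneg (by positivity)]
  exact_mod_cast h2

end Convergence

/-! ### Concentration of the sample second moment in terms of the horizon. -/

section OUDeviation

/-- The empirical second moment of the observations at the times `i δ`, `i = 1, …, n`. -/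
noncomputable def sampleSecondMoment {Ω : Type*} (X : ℝ≥0 → Ω → ℝ) (δ : ℝ≥0) (n : ℕ) (ω : Ω) : ℝ :=
  (∑ i ∈ Finset.range n, X (((i + 1 : ℕ) : ℝ≥0) * δ) ω ^ 2) / n

theorem approxMinContrast_eq {Ω : Type*} (X : ℝ≥0 → Ω → ℝ) (δ : ℝ≥0) (n : ℕ) (ω : Ω) :
    approxMinContrast X δ n ω = 1 / (2 * sampleSecondMoment X δ n ω) := by
  rw [approxMinContrast, sampleSecondMoment, Finset.range_eq_Ico,
    Finset.sum_Ico_add' (fun i : ℕ => X ((i : ℝ≥0) * δ) ω ^ 2) 0 n 1]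
  congr 1
  rw [zero_add, Finset.Ico_add_one_right_eq_Icc]
  ring

theorem exists_measure_sampleSecondMoment_le {θ ε : ℝ} (hθ : 0 < θ) (hε : 0 < ε) :
    ∃ c : ℝ, 0 < c ∧ ∀ {Ω : Type*} [MeasurableSpace Ω] {P : Measure Ω} {X : ℝ≥0 → Ω → ℝ},
      IsCenteredGaussian X (ouCov θ) P → (∀ t, Measurable (X t)) → (∀ ω, X 0 ω = 0) →
      ∀ (n : ℕ) (δ : ℝ≥0), 2 * θ * δ ≤ 1 →
      P {ω | ε ≤ |sampleSecondMoment X δ n ω - 1 / (2 * θ)|} ≤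
        ENNReal.ofReal (6 * Real.exp (-(c * (n * δ)))) := by
  obtain ⟨c, hc, h⟩ := exists_measure_mean_sq_sub_ge_le hθ hε
  refine ⟨c * θ, by positivity, ?_⟩
  intro Ω _ P X hX hm h0 n δ hδ
  have hP := hX.gaussian.isProbabilityMeasure
  have hδ0 : (0 : ℝ) ≤ δ := δ.2
  have hρ1 : Real.exp (-θ * δ) ≤ 1 := Real.exp_le_one_iff.2 (by nlinarith)
  refine (h (Real.exp_pos _).le hρ1 (hX.isGaussianAR hθ hm h0 δ) n).trans ?_
  refine ENNReal.ofReal_le_ofReal ?_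
  gcongr 6 * Real.exp (-?_)
  have e : Real.exp (-θ * δ) ^ 2 = Real.exp (-(2 * θ * δ)) := by
    rw [← Real.exp_nat_mul]; congr 1; push_cast; ring
  -- This is `1 - exp (-y) ≥ y/2` for `0 ≤ y ≤ 1`, with `y = 2θδ`.
  have h1 : θ * δ ≤ 1 - Real.exp (-θ * δ) ^ 2 := by
    rw [e]
    have hy : 0 ≤ 2 * θ * δ := by positivity
    have hinv : Real.exp (-(2 * θ * δ)) * Real.exp (2 * θ * δ) = 1 := by
      rw [← Real.exp_add]; simp
    have h2 := Real.add_one_le_exp (2 * θ * δ)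
    have h3 := Real.exp_pos (-(2 * θ * δ))
    nlinarith
  calc c * θ * (n * δ) = c * (n * (θ * δ)) := by ring
    _ ≤ _ := by gcongr

end OUDeviation

/-! ### Eighth Gaussian moment and Jensen inequalities for the fourth power. -/

section Moments

theorem lintegral_pow_eight_gaussianReal_le (w : ℝ≥0) :
    ∫⁻ x, ENNReal.ofReal (x ^ 8) ∂(gaussianReal 0 w) ≤ ENNReal.ofReal (12288 * (w : ℝ) ^ 4) := by
  rcases eq_or_ne w 0 with rfl | hw
  · simp [gaussianReal_zero_var, lintegral_dirac]
  have hw0 : (0 : ℝ) < w := NNReal.coe_pos.2 (pos_of_ne_zero hw)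
  -- From `y⁴/4! ≤ exp y` at `y = x²/(4w)`: `6144 = 4! · 4⁴`. The exponential moment adds a factor
  -- `2`; only the order `w⁴` matters.
  have hpt : ∀ x : ℝ, x ^ 8 ≤ 6144 * (w : ℝ) ^ 4 * Real.exp (1 / (4 * w) * x ^ 2) := by
    intro x
    have h := Real.pow_div_factorial_le_exp (1 / (4 * w) * x ^ 2) (by positivity) 4
    have e : x ^ 8 = 6144 * (w : ℝ) ^ 4 * ((1 / (4 * w) * x ^ 2) ^ 4 / (Nat.factorial 4 : ℕ)) := by
      norm_num [Nat.factorial]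
      field_simp
      ring
    rw [e]
    gcongr
  have hu : 1 / (4 * w) * (w : ℝ) = 1 / 4 := by field_simp
  have hm := lintegral_exp_mul_sq_gaussianReal_le (s := w) (u := 1 / (4 * w)) (by rw [hu]; norm_num)
  rw [hu] at hm
  have he : Real.exp (1 / 4 / (1 - 2 * (1 / 4))) ≤ 2 := by
    rw [← Real.le_log_iff_exp_le (by norm_num)]
    linarith [Real.log_two_gt_d9]
  calc _ ≤ ∫⁻ x, ENNReal.ofReal (6144 * (w : ℝ) ^ 4) *
        ENNReal.ofReal (Real.exp (1 / (4 * w) * x ^ 2)) ∂(gaussianReal 0 w) := by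
        refine lintegral_mono fun x => ?_
        rw [← ENNReal.ofReal_mul (by positivity)]
        exact ENNReal.ofReal_le_ofReal (hpt x)
    _ = ENNReal.ofReal (6144 * (w : ℝ) ^ 4) *
        ∫⁻ x, ENNReal.ofReal (Real.exp (1 / (4 * w) * x ^ 2)) ∂(gaussianReal 0 w) :=
        lintegral_const_mul _ (by fun_prop)
    _ ≤ ENNReal.ofReal (6144 * (w : ℝ) ^ 4) * ENNReal.ofReal 2 := by
        gcongr
        exact hm.trans (ENNReal.ofReal_le_ofReal he)
    _ = _ := by
        rw [← ENNReal.ofReal_mul (by positivity)]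
        congr 1; ring

theorem integral_pow_four_le {f : ℝ → ℝ} (hf : Continuous f) :
    (∫ u in (0 : ℝ)..1, f u) ^ 4 ≤ ∫ u in (0 : ℝ)..1, f u ^ 4 := by
  set m := ∫ u in (0 : ℝ)..1, f u with hm
  -- The tangent line to `y⁴` at the mean `m` lies below the graph.
  have h : ∫ u in (0 : ℝ)..1, (4 * m ^ 3 * f u - 3 * m ^ 4) ≤ ∫ u in (0 : ℝ)..1, f u ^ 4 := by
    have h1 : Continuous fun u => 4 * m ^ 3 * f u - 3 * m ^ 4 := by fun_prop
    have h2 : Continuous fun u => f u ^ 4 := by fun_prop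
    refine intervalIntegral.integral_mono_on zero_le_one (h1.intervalIntegrable _ _)
      (h2.intervalIntegrable _ _) fun u _ => ?_
    nlinarith [sq_nonneg (f u ^ 2 - m ^ 2), sq_nonneg (m * (f u - m)), sq_nonneg (m ^ 2)]
  rw [intervalIntegral.integral_sub ((hf.const_mul _).intervalIntegrable _ _) (by simp),
    intervalIntegral.integral_const_mul, intervalIntegral.integral_const, ← hm] at h
  simp only [sub_zero, one_smul] at h
  linarith

theorem mean_pow_four_le (a : ℕ → ℝ) {n : ℕ} (hn : 0 < n) :
    ((∑ i ∈ Finset.range n, a i) / n) ^ 4 ≤ (∑ i ∈ Finset.range n, a i ^ 4) / n := by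
  have hn' : (n : ℝ) ≠ 0 := by exact_mod_cast hn.ne'
  have h := Real.pow_arith_mean_le_arith_mean_pow_of_even (Finset.range n) (fun _ => 1 / (n : ℝ)) a
    (fun _ _ => by positivity) (by simp [hn']) (⟨2, rfl⟩ : Even 4)
  rw [← Finset.mul_sum, ← Finset.mul_sum] at h
  rwa [div_eq_inv_mul, div_eq_inv_mul, ← one_div]

end Moments

/-! ### Sample average against time average. -/

section Discretization

variable {Ω : Type*} [MeasurableSpace Ω] {P : Measure Ω} {θ : ℝ} {X : ℝ≥0 → Ω → ℝ}

/-- Factor `X_t² - X_s²` as difference times sum, and use `a⁴b⁴ ≤ (a⁸/δ² + δ²b⁸)/2`, whose weights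
balance `a⁸ ~ δ⁴` against `b⁸ ~ 1`. The fourth power is chosen because second moments would give
only order `δ`, and `∑ Δ_n` need not converge. -/
theorem IsCenteredGaussian.lintegral_sq_sub_sq_pow_four_le (hX : IsCenteredGaussian X (ouCov θ) P)
    (hθ : 0 < θ) {s t δ : ℝ≥0} (hδ : 0 < δ) (hst : s ≤ t) (hts : (t : ℝ) - s ≤ δ) :
    ∫⁻ ω, ENNReal.ofReal ((X t ω ^ 2 - X s ω ^ 2) ^ 4) ∂P ≤
      ENNReal.ofReal (6144 * (1 + (2 / θ) ^ 4) * (δ : ℝ) ^ 2) := by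
  obtain ⟨w₁, hw₁, h₁⟩ := hX.exists_hasLaw_sub hθ hst
  obtain ⟨w₂, hw₂, h₂⟩ := hX.exists_hasLaw_add hθ s t
  have hδ' : (0 : ℝ) < δ := hδ
  have hm₁ := h₁.aemeasurable
  have hm₂ := h₂.aemeasurable
  have m₁ : ∫⁻ ω, ENNReal.ofReal ((X t ω - X s ω) ^ 8) ∂P ≤ ENNReal.ofReal (12288 * (δ : ℝ) ^ 4) := by
    have h := lintegral_pow_eight_gaussianReal_le w₁
    rw [← h₁.map_eq, lintegral_map' (Measurable.aemeasurable (by fun_prop)) hm₁] at h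
    refine h.trans (ENNReal.ofReal_le_ofReal ?_)
    gcongr
    linarith
  have m₂ : ∫⁻ ω, ENNReal.ofReal ((X t ω + X s ω) ^ 8) ∂P ≤
      ENNReal.ofReal (12288 * (2 / θ) ^ 4) := by
    have h := lintegral_pow_eight_gaussianReal_le w₂
    rw [← h₂.map_eq, lintegral_map' (Measurable.aemeasurable (by fun_prop)) hm₂] at h
    refine h.trans (ENNReal.ofReal_le_ofReal ?_)
    gcongr
  have hpt : ∀ ω, ENNReal.ofReal ((X t ω ^ 2 - X s ω ^ 2) ^ 4) ≤
      ENNReal.ofReal (1 / (2 * (δ : ℝ) ^ 2)) * ENNReal.ofReal ((X t ω - X s ω) ^ 8)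
      + ENNReal.ofReal ((δ : ℝ) ^ 2 / 2) * ENNReal.ofReal ((X t ω + X s ω) ^ 8) := by
    intro ω
    rw [← ENNReal.ofReal_mul (by positivity), ← ENNReal.ofReal_mul (by positivity),
      ← ENNReal.ofReal_add (by positivity) (by positivity)]
    refine ENNReal.ofReal_le_ofReal ?_
    have e : 1 / (2 * (δ : ℝ) ^ 2) * (X t ω - X s ω) ^ 8 + (δ : ℝ) ^ 2 / 2 * (X t ω + X s ω) ^ 8
        - (X t ω ^ 2 - X s ω ^ 2) ^ 4
        = ((X t ω - X s ω) ^ 4 / δ - δ * (X t ω + X s ω) ^ 4) ^ 2 / 2 := by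
      field_simp; ring
    have : 0 ≤ ((X t ω - X s ω) ^ 4 / δ - δ * (X t ω + X s ω) ^ 4) ^ 2 / 2 := by positivity
    linarith
  calc _ ≤ _ := lintegral_mono hpt
    _ = ENNReal.ofReal (1 / (2 * (δ : ℝ) ^ 2)) * ∫⁻ ω, ENNReal.ofReal ((X t ω - X s ω) ^ 8) ∂P
      + ENNReal.ofReal ((δ : ℝ) ^ 2 / 2) * ∫⁻ ω, ENNReal.ofReal ((X t ω + X s ω) ^ 8) ∂P := by
        rw [lintegral_add_left' (by fun_prop), lintegral_const_mul'' _ (by fun_prop),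
          lintegral_const_mul'' _ (by fun_prop)]
    _ ≤ ENNReal.ofReal (1 / (2 * (δ : ℝ) ^ 2)) * ENNReal.ofReal (12288 * (δ : ℝ) ^ 4)
      + ENNReal.ofReal ((δ : ℝ) ^ 2 / 2) * ENNReal.ofReal (12288 * (2 / θ) ^ 4) := by gcongr
    _ = _ := by
        rw [← ENNReal.ofReal_mul (by positivity), ← ENNReal.ofReal_mul (by positivity),
          ← ENNReal.ofReal_add (by positivity) (by positivity)]
        congr 1
        field_simp
        ring

/-- The time average of the squared path over `[0, T]`. -/
noncomputable def timeSecondMoment {Ω : Type*} (X : ℝ≥0 → Ω → ℝ) (T : ℝ) (ω : Ω) : ℝ :=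
  (∫ s in (0 : ℝ)..T, X s.toNNReal ω ^ 2) / T

theorem measurable_timeSecondMoment (hm : ∀ t, Measurable (X t))
    (hc : ∀ ω, Continuous fun t => X t ω) {T : ℝ} (hT : 0 ≤ T) :
    Measurable (timeSecondMoment X T) := by
  have hXm : Measurable fun q : ℝ≥0 × Ω => X q.1 q.2 :=
    measurable_uncurry_of_continuous_of_measurable hc hm
  have h : Measurable fun q : Ω × ℝ => X q.2.toNNReal q.1 ^ 2 :=
    (hXm.comp (f := fun q : Ω × ℝ => (q.2.toNNReal, q.1)) (by fun_prop)).pow_const 2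
  have h2 : Measurable fun ω => ∫ s in Set.Ioc 0 T, X s.toNNReal ω ^ 2 :=
    h.stronglyMeasurable.integral_prod_right.measurable
  unfold timeSecondMoment
  simp_rw [intervalIntegral.integral_of_le hT]
  exact h2.div_const T

/-- Rescaling every cell to `[0, 1]` makes the discretization error an average, over cells and over
`u`, of differences at distance at most `δ`. -/
theorem integral_mean_sub_eq {x : ℝ → ℝ} (hx : Continuous x) {δ : ℝ} (hδ : 0 < δ) {n : ℕ}
    (hn : 0 < n) :
    ∫ u in (0 : ℝ)..1, (∑ i ∈ Finset.range n, (x ((i + 1 : ℕ) * δ) - x (δ * u + i * δ))) / n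
      = (∑ i ∈ Finset.range n, x ((i + 1 : ℕ) * δ)) / n - (∫ s in (0 : ℝ)..(n * δ), x s) / (n * δ) := by
  have hn' : (n : ℝ) ≠ 0 := by exact_mod_cast hn.ne'
  have h1 : ∀ i : ℕ, ∫ u in (0 : ℝ)..1, x (δ * u + i * δ)
      = δ⁻¹ * ∫ s in (i * δ : ℝ)..((i + 1 : ℕ) * δ), x s := by
    intro i
    rw [intervalIntegral.integral_comp_mul_add _ hδ.ne', smul_eq_mul]
    congr 2 <;> push_cast <;> ring
  have h2 := intervalIntegral.sum_integral_adjacent_intervals (f := x) (μ := volume)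
    (a := fun i : ℕ => (i : ℝ) * δ) (n := n) fun k _ => hx.intervalIntegrable _ _
  simp only [Nat.cast_zero, zero_mul] at h2
  rw [intervalIntegral.integral_div, intervalIntegral.integral_finsetSum fun i _ =>
    (by fun_prop : Continuous _).intervalIntegrable _ _]
  have h3 : ∀ i ∈ Finset.range n, ∫ u in (0 : ℝ)..1, (x ((i + 1 : ℕ) * δ) - x (δ * u + i * δ))
      = x ((i + 1 : ℕ) * δ) - δ⁻¹ * ∫ s in (i * δ : ℝ)..((i + 1 : ℕ) * δ), x s := by
    intro i _
    rw [intervalIntegral.integral_sub (by simp) ((by fun_prop : Continuous _).intervalIntegrable _ _),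
      h1]
    simp
  rw [Finset.sum_congr rfl h3, Finset.sum_sub_distrib, ← Finset.mul_sum, h2, sub_div]
  congr 1
  field_simp

/-- Jensen in `u` and over the cells moves the fourth power inside; Tonelli then reduces to
`lintegral_sq_sub_sq_pow_four_le`. -/
theorem IsCenteredGaussian.lintegral_discretization_error_le
    (hX : IsCenteredGaussian X (ouCov θ) P) (hθ : 0 < θ) (hm : ∀ t, Measurable (X t))
    (hc : ∀ ω, Continuous fun t => X t ω) {δ : ℝ≥0} (hδ : 0 < δ) {n : ℕ} (hn : 0 < n) :
    ∫⁻ ω, ENNReal.ofReal ((sampleSecondMoment X δ n ω - timeSecondMoment X (n * δ) ω) ^ 4) ∂P ≤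
      ENNReal.ofReal (6144 * (1 + (2 / θ) ^ 4) * (δ : ℝ) ^ 2) := by
  have hP := hX.gaussian.isProbabilityMeasure
  have hδ' : (0 : ℝ) < δ := hδ
  have hn' : (0 : ℝ) < n := by exact_mod_cast hn
  set R := ENNReal.ofReal (6144 * (1 + (2 / θ) ^ 4) * (δ : ℝ) ^ 2) with hR
  set d : ℕ → ℝ → Ω → ℝ := fun i u ω => X ((((i + 1 : ℕ) : ℝ) * δ).toNNReal) ω ^ 2
    - X ((δ * u + i * δ : ℝ).toNNReal) ω ^ 2 with hd
  have hXm : Measurable fun q : ℝ≥0 × Ω => X q.1 q.2 :=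
    measurable_uncurry_of_continuous_of_measurable hc hm
  have hdm : ∀ i, Measurable fun q : ℝ × Ω => d i q.1 q.2 := by
    intro i
    have h1 : Measurable fun q : ℝ × Ω => X ((δ * q.1 + i * δ : ℝ).toNNReal) q.2 :=
      hXm.comp (f := fun q : ℝ × Ω => ((δ * q.1 + i * δ : ℝ).toNNReal, q.2)) (by fun_prop)
    have h2 : Measurable fun q : ℝ × Ω => X ((((i + 1 : ℕ) : ℝ) * δ).toNNReal) q.2 :=
      (hm _).comp measurable_snd
    exact (h2.pow_const 2).sub (h1.pow_const 2)
  have hdc : ∀ i ω, Continuous fun u => d i u ω := by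
    intro i ω
    have h1 : Continuous fun u : ℝ => X ((δ * u + i * δ : ℝ).toNNReal) ω :=
      (hc ω).comp (by fun_prop)
    exact continuous_const.sub (h1.pow 2)
  have hpt : ∀ ω, ENNReal.ofReal ((sampleSecondMoment X δ n ω
      - timeSecondMoment X (n * δ) ω) ^ 4) ≤
      ∫⁻ u in Set.Ioc (0 : ℝ) 1, ENNReal.ofReal (n : ℝ)⁻¹ *
        ∑ i ∈ Finset.range n, ENNReal.ofReal (d i u ω ^ 4) := by
    intro ω
    have hx : Continuous fun s : ℝ => X s.toNNReal ω ^ 2 :=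
      ((hc ω).comp continuous_real_toNNReal).pow 2
    have hcont : Continuous fun u => (∑ i ∈ Finset.range n, d i u ω) / n :=
      (continuous_finsetSum _ fun i _ => hdc i ω).div_const _
    have e : sampleSecondMoment X δ n ω - timeSecondMoment X (n * δ) ω
        = ∫ u in (0 : ℝ)..1, (∑ i ∈ Finset.range n, d i u ω) / n := by
      rw [hd, integral_mean_sub_eq hx hδ' hn, sampleSecondMoment, timeSecondMoment]
      congr 2
      refine Finset.sum_congr rfl fun i _ => ?_
      congr 2
      rw [← NNReal.coe_natCast, ← NNReal.coe_mul, Real.toNNReal_coe]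
    rw [e]
    calc _ ≤ ENNReal.ofReal (∫ u in (0 : ℝ)..1, ((∑ i ∈ Finset.range n, d i u ω) / n) ^ 4) :=
          ENNReal.ofReal_le_ofReal (integral_pow_four_le hcont)
      _ = ∫⁻ u in Set.Ioc (0 : ℝ) 1, ENNReal.ofReal (((∑ i ∈ Finset.range n, d i u ω) / n) ^ 4) := by
          rw [intervalIntegral.integral_of_le zero_le_one, ofReal_integral_eq_lintegral_ofReal
            (show IntegrableOn (fun u => ((∑ i ∈ Finset.range n, d i u ω) / n) ^ 4) _ _ from
              ((hcont.pow 4).intervalIntegrable 0 1).1) (Eventually.of_forall fun u => by positivity)]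
      _ ≤ _ := by
          refine lintegral_mono fun u => ?_
          rw [← ENNReal.ofReal_sum_of_nonneg fun i _ => by positivity,
            ← ENNReal.ofReal_mul (by positivity), inv_mul_eq_div]
          exact ENNReal.ofReal_le_ofReal (mean_pow_four_le _ hn)
  have hjm : Measurable fun q : Ω × ℝ => ENNReal.ofReal (n : ℝ)⁻¹ *
        ∑ i ∈ Finset.range n, ENNReal.ofReal (d i q.2 q.1 ^ 4) := by
    refine Measurable.const_mul (Finset.measurable_fun_sum _ fun i _ => ?_) _
    exact ENNReal.measurable_ofReal.comp (((hdm i).comp measurable_swap).pow_const 4)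
  calc _ ≤ ∫⁻ ω, (∫⁻ u in Set.Ioc (0 : ℝ) 1, ENNReal.ofReal (n : ℝ)⁻¹ *
        ∑ i ∈ Finset.range n, ENNReal.ofReal (d i u ω ^ 4)) ∂P := lintegral_mono hpt
    _ = ∫⁻ u in Set.Ioc (0 : ℝ) 1, (∫⁻ ω, ENNReal.ofReal (n : ℝ)⁻¹ *
        ∑ i ∈ Finset.range n, ENNReal.ofReal (d i u ω ^ 4) ∂P) :=
        lintegral_lintegral_swap hjm.aemeasurable
    _ ≤ ∫⁻ u in Set.Ioc (0 : ℝ) 1, R := by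
        refine setLIntegral_mono measurable_const fun u hu => ?_
        have hdu : ∀ i, Measurable fun ω => ENNReal.ofReal (d i u ω ^ 4) := fun i =>
          ENNReal.measurable_ofReal.comp (((hdm i).comp measurable_prodMk_left).pow_const 4)
        rw [lintegral_const_mul _ (Finset.measurable_fun_sum _ fun i _ => hdu i),
          lintegral_finsetSum _ fun i _ => hdu i]
        calc _ ≤ ENNReal.ofReal (n : ℝ)⁻¹ * ∑ i ∈ Finset.range n, R := by
              gcongr with i hi
              have hnn : 0 ≤ δ * u + i * δ := by
                have := hu.1; positivity
              refine hX.lintegral_sq_sub_sq_pow_four_le hθ hδ (Real.toNNReal_le_toNNReal ?_) ?_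
              · push_cast; nlinarith [hu.2]
              · rw [Real.coe_toNNReal _ hnn, Real.coe_toNNReal _ (by positivity)]
                push_cast; nlinarith [hu.1]
          _ = R := by
              rw [Finset.sum_const, Finset.card_range, nsmul_eq_mul, ← mul_assoc,
                ← ENNReal.ofReal_natCast n, ← ENNReal.ofReal_mul (by positivity),
                inv_mul_cancel₀ hn'.ne', ENNReal.ofReal_one, one_mul]
    _ = R := by simp

theorem IsCenteredGaussian.measure_discretization_error_le
    (hX : IsCenteredGaussian X (ouCov θ) P) (hθ : 0 < θ) (hm : ∀ t, Measurable (X t))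
    (hc : ∀ ω, Continuous fun t => X t ω) {δ : ℝ≥0} (hδ : 0 < δ) {n : ℕ} (hn : 0 < n)
    {ε : ℝ} (hε : 0 < ε) :
    P {ω | ε ≤ |sampleSecondMoment X δ n ω - timeSecondMoment X (n * δ) ω - 0|} ≤
      ENNReal.ofReal (6144 * (1 + (2 / θ) ^ 4) / ε ^ 4 * (δ : ℝ) ^ 2) := by
  have h := hX.lintegral_discretization_error_le hθ hm hc hδ hn
  set D : Ω → ℝ := fun ω => sampleSecondMoment X δ n ω - timeSecondMoment X (n * δ) ω with hD
  have hsub : {ω | ε ≤ |D ω - 0|} ⊆ {ω | ENNReal.ofReal (ε ^ 4) ≤ ENNReal.ofReal (D ω ^ 4)} := by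
    intro ω hω
    rw [Set.mem_ofPred_eq, sub_zero] at hω
    refine ENNReal.ofReal_le_ofReal ?_
    calc ε ^ 4 ≤ |D ω| ^ 4 := by gcongr
      _ = D ω ^ 4 := by rw [Even.pow_abs ⟨2, rfl⟩]
  have hDm : Measurable D := by
    refine Measurable.sub ?_ (measurable_timeSecondMoment hm hc (by positivity))
    unfold sampleSecondMoment
    fun_prop
  refine (measure_mono hsub).trans ((meas_ge_le_lintegral_div (by fun_prop)
    (ENNReal.ofReal_pos.2 (by positivity)).ne' ENNReal.ofReal_ne_top).trans ?_)
  refine (ENNReal.div_le_div_right h _).trans ?_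
  rw [← ENNReal.ofReal_div_of_pos (by positivity)]
  refine ENNReal.ofReal_le_ofReal (le_of_eq ?_)
  ring

end Discretization

/-! ### Ergodicity and limits of the sample second moment. -/

section Ergodic

variable {Ω : Type*} [MeasurableSpace Ω] {P : Measure Ω} {θ : ℝ} {X : ℝ≥0 → Ω → ℝ}

/-- `F T` lies between its values at `⌊T⌋` and `⌊T⌋ + 1`, and both integers are asymptotic to `T`.
-/
theorem tendsto_div_of_monotone_of_tendsto_nat {F : ℝ → ℝ} {g : ℝ} (hF : MonotoneOn F (Set.Ici 0))
    (h : Tendsto (fun m : ℕ => F m / m) atTop (𝓝 g)) :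
    Tendsto (fun T => F T / T) atTop (𝓝 g) := by
  have hfl : Tendsto (fun T : ℝ => ⌊T⌋₊) atTop atTop := tendsto_nat_floor_atTop
  have hr : Tendsto (fun T : ℝ => (⌊T⌋₊ : ℝ) / T) atTop (𝓝 1) := tendsto_nat_floor_div_atTop
  have hr' : Tendsto (fun T : ℝ => ((⌊T⌋₊ + 1 : ℕ) : ℝ) / T) atTop (𝓝 1) := by
    have := hr.add tendsto_inv_atTop_zero
    rw [add_zero] at this
    refine this.congr fun T => ?_
    push_cast; ring
  have hlow := (h.comp hfl).mul hr
  have hup := (((tendsto_add_atTop_iff_nat 1).2 h).comp hfl).mul hr'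
  rw [mul_one] at hlow hup
  refine tendsto_of_tendsto_of_tendsto_of_le_of_le' hlow hup ?_ ?_
  · filter_upwards [eventually_ge_atTop 1] with T hT
    have hm : (⌊T⌋₊ : ℝ) ≠ 0 := by
      have := Nat.floor_pos.2 hT
      positivity
    simp only [Function.comp_apply]
    rw [div_mul_div_cancel₀ hm]
    gcongr
    exact hF (Set.mem_Ici.2 (Nat.cast_nonneg _)) (zero_le_one.trans hT) (Nat.floor_le (by linarith))
  · filter_upwards [eventually_ge_atTop 1] with T hT
    simp only [Function.comp_apply]
    rw [div_mul_div_cancel₀ (by positivity)]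
    gcongr
    refine hF (zero_le_one.trans hT) (Set.mem_Ici.2 (Nat.cast_nonneg _)) ?_
    exact_mod_cast (Nat.lt_floor_add_one T).le

theorem IsCenteredGaussian.ae_tendsto_discretization_error
    (hX : IsCenteredGaussian X (ouCov θ) P) (hθ : 0 < θ) (hm : ∀ t, Measurable (X t))
    (hc : ∀ ω, Continuous fun t => X t ω) {N : ℕ → ℕ} {Δ : ℕ → ℝ≥0}
    (hpos : ∀ᶠ k in atTop, 0 < N k ∧ 0 < Δ k) (hΔ : Summable fun k => (Δ k : ℝ) ^ 2) :
    ∀ᵐ ω ∂P, Tendsto (fun k => sampleSecondMoment X (Δ k) (N k) ω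
      - timeSecondMoment X (N k * Δ k) ω) atTop (𝓝 0) := by
  refine ae_tendsto_of_summable_measure fun ε hε =>
    ⟨_, hΔ.mul_left (6144 * (1 + (2 / θ) ^ 4) / ε ^ 4), ?_⟩
  filter_upwards [hpos] with k hk
  exact hX.measure_discretization_error_le hθ hm hc hk.2 hk.1 hε

theorem IsCenteredGaussian.ae_tendsto_sampleSecondMoment
    (hX : IsCenteredGaussian X (ouCov θ) P) (hθ : 0 < θ) (hm : ∀ t, Measurable (X t))
    (h0 : ∀ ω, X 0 ω = 0) {N : ℕ → ℕ} {Δ : ℕ → ℝ≥0} (hΔ : Tendsto Δ atTop (𝓝 0))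
    (hsum : ∀ c : ℝ, 0 < c → Summable fun k => Real.exp (-(c * (N k * Δ k)))) :
    ∀ᵐ ω ∂P, Tendsto (fun k => sampleSecondMoment X (Δ k) (N k) ω) atTop (𝓝 (1 / (2 * θ))) := by
  refine ae_tendsto_of_summable_measure fun ε hε => ?_
  obtain ⟨c, hc, h⟩ := exists_measure_sampleSecondMoment_le hθ hε
  refine ⟨_, (hsum c hc).mul_left 6, ?_⟩
  have hlim : Tendsto (fun k => 2 * θ * (Δ k : ℝ)) atTop (𝓝 0) := by
    simpa using ((NNReal.continuous_coe.tendsto 0).comp hΔ).const_mul (2 * θ)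
  filter_upwards [hlim.eventually_le_const one_pos] with k hk
  exact h hX hm h0 _ _ hk

/-- Ergodicity of the Ornstein-Uhlenbeck process for the squared path. -/
theorem IsCenteredGaussian.ae_tendsto_timeSecondMoment
    (hX : IsCenteredGaussian X (ouCov θ) P) (hθ : 0 < θ) (hm : ∀ t, Measurable (X t))
    (hc : ∀ ω, Continuous fun t => X t ω) (h0 : ∀ ω, X 0 ω = 0) :
    ∀ᵐ ω ∂P, Tendsto (fun T => timeSecondMoment X T ω) atTop (𝓝 (1 / (2 * θ))) := by
  -- Auxiliary grid: `m²` points of mesh `1/m` reach time `m`, so both `exp (-cm)` and the squared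
  -- mesh are summable. At `m = 0` the convention `0⁻¹ = 0` keeps the identity true.
  have hT : ∀ m : ℕ, ((m ^ 2 : ℕ) : ℝ) * ((m : ℝ≥0)⁻¹ : ℝ≥0) = m := by
    intro m
    rcases eq_or_ne m 0 with rfl | hm0
    · simp
    · have : (m : ℝ) ≠ 0 := by exact_mod_cast hm0
      push_cast
      field_simp
  have h1 := hX.ae_tendsto_sampleSecondMoment hθ hm h0 (N := fun m => m ^ 2)
    (Δ := fun m => (m : ℝ≥0)⁻¹) tendsto_inv_atTop_nhds_zero_nat (fun c hc => by
      simp_rw [hT]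
      have e : ∀ m : ℕ, Real.exp (-(c * m)) = Real.exp (-c) ^ m := fun m => by
        rw [← Real.exp_nat_mul]; congr 1; ring
      simp_rw [e]
      exact summable_geometric_of_lt_one (Real.exp_pos _).le (Real.exp_lt_one_iff.2 (by linarith)))
  have h2 := hX.ae_tendsto_discretization_error hθ hm hc (N := fun m => m ^ 2)
    (Δ := fun m => (m : ℝ≥0)⁻¹) (by
      filter_upwards [eventually_gt_atTop 0] with m hm0
      exact ⟨by positivity, by positivity⟩) (by
      simp)
  filter_upwards [h1, h2] with ω k1 k2
  have hx : Continuous fun s : ℝ => X s.toNNReal ω ^ 2 :=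
    ((hc ω).comp continuous_real_toNNReal).pow 2
  refine tendsto_div_of_monotone_of_tendsto_nat (F := fun T => ∫ s in (0 : ℝ)..T,
    X s.toNNReal ω ^ 2) (fun a ha b _ hab => ?_) ?_
  · exact intervalIntegral.integral_mono_interval le_rfl ha hab
      (Eventually.of_forall fun s => sq_nonneg _) (hx.intervalIntegrable _ _)
  · have := k1.sub k2
    simp only [sub_sub_cancel, sub_zero, hT] at this
    exact this

theorem IsCenteredGaussian.tendsto_measure_sampleSecondMoment
    (hX : IsCenteredGaussian X (ouCov θ) P) (hθ : 0 < θ) (hm : ∀ t, Measurable (X t))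
    (h0 : ∀ ω, X 0 ω = 0) {Δ : ℕ → ℝ≥0} (hΔ : Tendsto Δ atTop (𝓝 0))
    (hT : Tendsto (fun n : ℕ => (n : ℝ) * (Δ n : ℝ)) atTop atTop) {ε : ℝ} (hε : 0 < ε) :
    Tendsto (fun n => P {ω | ε ≤ |sampleSecondMoment X (Δ n) n ω - 1 / (2 * θ)|}) atTop (𝓝 0) := by
  obtain ⟨c, hc, h⟩ := exists_measure_sampleSecondMoment_le hθ hε
  have hlim : Tendsto (fun k => 2 * θ * (Δ k : ℝ)) atTop (𝓝 0) := by
    simpa using ((NNReal.continuous_coe.tendsto 0).comp hΔ).const_mul (2 * θ)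
  have hb : Tendsto (fun n : ℕ => ENNReal.ofReal (6 * Real.exp (-(c * (n * Δ n))))) atTop (𝓝 0) := by
    have := (Real.tendsto_exp_neg_atTop_nhds_zero.comp (hT.const_mul_atTop hc)).const_mul 6
    rw [mul_zero] at this
    simpa using ENNReal.tendsto_ofReal this
  refine tendsto_of_tendsto_of_tendsto_of_le_of_le' tendsto_const_nhds hb
    (Eventually.of_forall fun _ => zero_le) ?_
  filter_upwards [hlim.eventually_le_const one_pos] with k hk
  exact h hX hm h0 _ _ hk

end Ergodic

/-! ### Consistency of the estimator. -/

theorem theorem3p4 {Ω : Type*} [MeasurableSpace Ω] (P : Measure Ω) [IsProbabilityMeasure P]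
    (θ : ℝ) (hθ : 0 < θ) (W X : ℝ≥0 → Ω → ℝ) (hW : IsBrownianReal W P)
    (hX : IsOrnsteinUhlenbeck θ W X P) (Δ : ℕ → ℝ≥0)
    (hΔ : Tendsto Δ atTop (𝓝 0))
    (hT : Tendsto (fun n : ℕ => (n : ℝ) * (Δ n : ℝ)) atTop atTop) :
    TendstoInMeasure P (fun n ω => approxMinContrast X (Δ n) n ω) atTop (fun _ => θ) ∧
    (((∃ η : ℝ, 1 < η ∧ η < 2 ∧
          Tendsto (fun n : ℕ => (n : ℝ) * (Δ n : ℝ) ^ η) atTop (𝓝 0)) ∨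
        (∃ η : ℝ, 1 < η ∧
          Tendsto (fun n : ℕ => (n : ℝ) * (Δ n : ℝ) ^ η) atTop atTop)) →
      ∀ᵐ ω ∂P, Tendsto (fun n : ℕ => approxMinContrast X (Δ n) n ω) atTop (𝓝 θ)) := by
  have hG := hX.isCenteredGaussian hθ hW.toIsPreBrownianReal
  obtain ⟨Y, hm, hc, h0, hYX⟩ := exists_measurable_continuous_modification
    (fun t => hG.gaussian.aemeasurable t) hX.cont hX.init
  have hY : IsCenteredGaussian Y (ouCov θ) P := hG.congr fun t => by
    filter_upwards [hYX] with ω hω using (hω t).symm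
  have hest : ∀ᵐ ω ∂P, ∀ n, approxMinContrast X (Δ n) n ω
      = 1 / (2 * sampleSecondMoment Y (Δ n) n ω) := by
    filter_upwards [hYX] with ω hω n
    simp only [approxMinContrast_eq, sampleSecondMoment, hω]
  refine ⟨?_, fun hη => ?_⟩
  · rw [tendstoInMeasure_iff_dist]
    intro ε hε
    obtain ⟨δ, hδ, h⟩ := exists_abs_sub_lt_imp_abs_one_div_sub_lt hθ hε
    refine tendsto_of_tendsto_of_tendsto_of_le_of_le tendsto_const_nhds
      (hY.tendsto_measure_sampleSecondMoment hθ hm h0 hΔ hT hδ) (fun _ => zero_le) fun n => ?_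
    refine measure_mono_ae ?_
    filter_upwards [hest] with ω hω (hdist : ε ≤ dist _ _)
    rw [hω, Real.dist_eq] at hdist
    exact not_lt.1 fun hlt => hdist.not_gt (h _ hlt)
  · suffices hS : ∀ᵐ ω ∂P, Tendsto (fun n => sampleSecondMoment Y (Δ n) n ω) atTop
        (𝓝 (1 / (2 * θ))) by
      filter_upwards [hS, hest] with ω h1 h2
      simp_rw [h2]
      exact tendsto_one_div_two_mul hθ h1
    -- In the first regime `nΔ_n` may grow too slowly for the exponential bounds to be summable, so
    -- the time average intervenes; in the second they are summable.
    rcases hη with ⟨η, hη1, hη2, hlim⟩ | ⟨η, hη1, hlim⟩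
    · have hpos : ∀ᶠ n in atTop, 0 < n ∧ 0 < Δ n := by
        filter_upwards [hT.eventually_gt_atTop 0] with n hn
        refine ⟨Nat.pos_of_ne_zero ?_, pos_of_ne_zero ?_⟩
        · rintro rfl; simp at hn
        · intro h; simp [h] at hn
      filter_upwards [hY.ae_tendsto_timeSecondMoment hθ hm hc h0,
        hY.ae_tendsto_discretization_error hθ hm hc (N := fun n => n) hpos
          (summable_sq_of_tendsto hη1 hη2 (fun n => (Δ n).2) hlim)] with ω h1 h2
      simpa using h2.add (h1.comp hT)
    · exact hY.ae_tendsto_sampleSecondMoment hθ hm h0 (N := fun n => n) hΔ fun c hc' =>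
        summable_exp_neg_mul_of_tendsto hc' hη1 (fun n => (Δ n).2) hlim
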